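/- Let $\mathcal{A}$ be a locally noetherian Grothendieck cosmos, that is, a locally noetherian Grothendieck category with a closed symmetric monoidal structure $(\otimes, I)$, and assume (C1) the unit object $I$ is finitely presented. Write $\mathcal{A}_{\mathrm{noeth}}$ for the full subcategory of noetherian objects. Subcategories are full and closed under isomorphisms. An additive subcategory of an abelian category is called a *torsion class* if it is closed under quotients and extensions; a *torsion-free class* if it is closed under subobjects and extensions; *Serre* if it is closed under subobjects, quotients and extensions; *wide* if it is closed under kernels, cokernels and extensions; and *ICE-closed* (resp. *CE-closed*, *IKE-closed*, *IE-closed*) if it is closed under images, cokernels and extensions (resp. cokernels and extensions; images, kernels and extensions; images and extensions). A *localizing* subcategory of $\mathcal{A}$ is a Serre subcategory closed under small coproducts. An object $L$ is *invertible* if $L\otimes M\cong I$ for some $M$; $\operatorname{Pic}\mathcal{A}$ is the group of isomorphism classes of invertible objects, which acts on $\mathcal{A}$ by tensor product. A subcategory $\mathcal{X}$ is *L-closed* if $X\otimes L\in\mathcal{X}$ for all $X\in\mathcal{X}$ and all invertible $L$. An *action* of a group $G$ on $\mathcal{A}$ is a group homomorphism from $G$ to the group of isomorphism classes of autoequivalences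 of $\mathcal{A}$, and $\mathcal{X}$ is *$G$-closed* if $g\cdot X\in\mathcal{X}$ for all $g\in G$ and $X\in\mathcal{X}$. Consider the following conditions. * (C2) $\mathcal{A}$ is generated by a small set of dualizable objects. * $\mathrm{Loc}_\otimes\mathcal{A}=\mathrm{Loc}_G\mathcal{A}$: a localizing subcategory of $\mathcal{A}$ is a tensor ideal of $\mathcal{A}$ if and only if it is $G$-closed. * $\mathrm{tors}_\otimes\mathcal{A}_{\mathrm{noeth}}=\mathrm{tors}_G\mathcal{A}_{\mathrm{noeth}}$: a torsion class of $\mathcal{A}_{\mathrm{noeth}}$ is a tensor ideal of $\mathcal{A}_{\mathrm{noeth}}$ if and only if it is $G$-closed. Then the following hold. **(I)** Let a group $G$ act on $\mathcal{A}$ and suppose that (C2), $\mathrm{Loc}_\otimes\mathcal{A}=\mathrm{Loc}_G\mathcal{A}$ and $\mathrm{tors}_\otimes\mathcal{A}_{\mathrm{noeth}}=\mathrm{tors}_G\mathcal{A}_{\mathrm{noeth}}$ hold. Let $\mathcal{X}$ be a $G$-closed subcategory of $\mathcal{A}_{\mathrm{noeth}}$. 1. The following are equivalent in $\mathcal{A}_{\mathrm{noeth}}$: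 $\mathcal{X}$ is a Serre subcategory; $\mathcal{X}$ is a torsion class; $\mathcal{X}$ is wide; $\mathcal{X}$ is ICE-closed; $\mathcal{X}$ is CE-closed. 2. The following are equivalent in $\mathcal{A}_{\mathrm{noeth}}$: $\mathcal{X}$ is a torsion-free class; $\mathcal{X}$ is IKE-closed; $\mathcal{X}$ is IE-closed. **(II)** Let $\mathcal{L}\subseteq\operatorname{Pic}\mathcal{A}$ be a set such that $\mathcal{A}$ is generated by a small set of objects that are finite iterated extensions of objects of the form $L^{\otimes n}$ with $L\in\mathcal{L}$ and $n\in\mathbb{Z}$. Then (C2), $\mathrm{Loc}_\otimes\mathcal{A}=\mathrm{Loc}_G\mathcal{A}$ and $\mathrm{tors}_\otimes\mathcal{A}_{\mathrm{noeth}}=\mathrm{tors}_G\mathcal{A}_{\mathrm{noeth}}$ hold for the subgroup $G$ of $\operatorname{Pic}\mathcal{A}$ generated by $\mathcal{L}$. **(III)** Suppose that $\mathcal{A}$ is generated by a small set of invertible-filtered objects, that is, of finite iterated extensions of invertible objects. Then the equivalences 1 and 2 of (I) hold for every L-closed subcategory $\mathcal{X}$ of $\mathcal{A}_{\mathrm{noeth}}$.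 -/

import Mathlib

open CategoryTheory CategoryTheory.Limits MonoidalCategory

universe w v u

/-! ### Classes of subcategories of an abelian category

A subcategory (full and closed under isomorphisms) is an `ObjectProperty`.  In the classes below
only the zero object is required explicitly: closure under finite direct sums and under
isomorphisms then follows from closure under extensions.  Serre subcategories are Mathlib's
`ObjectProperty.IsSerreClass`. -/

section Subcategories

variable {A : Type u} [Category.{v} A] [Abelian A]

/-- `P` is closed under images of morphisms between its objects. -/
def IsClosedUnderImages (P : ObjectProperty A) : Prop :=
  ∀ ⦃X Y : A⦄ (f : X ⟶ Y), P X → P Y → P (Limits.image f)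

/-- Torsion class: an additive subcategory closed under quotients and extensions. -/
structure IsTorsionClass (P : ObjectProperty A) : Prop where
  containsZero : P.ContainsZero
  quotients : P.IsClosedUnderQuotients
  extensions : P.IsClosedUnderExtensions

/-- Torsion-free class: an additive subcategory closed under subobjects and extensions. -/
structure IsTorsionFreeClass (P : ObjectProperty A) : Prop where
  containsZero : P.ContainsZero
  subobjects : P.IsClosedUnderSubobjects
  extensions : P.IsClosedUnderExtensions

/-- Wide: an additive subcategory closed under kernels, cokernels and extensions. -/
structure IsWide (P : ObjectProperty A) : Prop where
  containsZero : P.ContainsZero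
  kernels : P.IsClosedUnderKernels
  cokernels : P.IsClosedUnderCokernels
  extensions : P.IsClosedUnderExtensions

/-- ICE-closed: an additive subcategory closed under images, cokernels and extensions. -/
structure IsICEClosed (P : ObjectProperty A) : Prop where
  containsZero : P.ContainsZero
  images : IsClosedUnderImages P
  cokernels : P.IsClosedUnderCokernels
  extensions : P.IsClosedUnderExtensions

/-- CE-closed: an additive subcategory closed under cokernels and extensions. -/
structure IsCEClosed (P : ObjectProperty A) : Prop where
  containsZero : P.ContainsZero
  cokernels : P.IsClosedUnderCokernels
  extensions : P.IsClosedUnderExtensions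

/-- IKE-closed: an additive subcategory closed under images, kernels and extensions. -/
structure IsIKEClosed (P : ObjectProperty A) : Prop where
  containsZero : P.ContainsZero
  images : IsClosedUnderImages P
  kernels : P.IsClosedUnderKernels
  extensions : P.IsClosedUnderExtensions

/-- IE-closed: an additive subcategory closed under images and extensions. -/
structure IsIEClosed (P : ObjectProperty A) : Prop where
  containsZero : P.ContainsZero
  images : IsClosedUnderImages P
  extensions : P.IsClosedUnderExtensions

/-- Localizing subcategory: a Serre subcategory closed under small coproducts. -/
structure IsLocalizingSubcat [HasCoproducts.{v} A] (P : ObjectProperty A) : Prop where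
  serre : P.IsSerreClass
  coproducts : ∀ (ι : Type v) (X : ι → A), (∀ i, P (X i)) → P (∐ X)

/-- The `P`-filtered objects: finite iterated extensions of objects of `P`, that is, objects
admitting a finite filtration starting at zero whose successive quotients lie in `P`. -/
inductive Filtered (P : ObjectProperty A) : ObjectProperty A
  | zero (X : A) (hX : IsZero X) : Filtered P X
  | step (S : ShortComplex A) (hS : S.ShortExact) (h₁ : Filtered P S.X₁) (h₃ : P S.X₃) :
      Filtered P S.X₂

/-- `A` has a small generating set consisting of objects of `P`. -/
def GeneratedBySmallSetOf (P : ObjectProperty A) : Prop :=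
  ∃ (ι : Type v) (E : ι → A), (∀ i, P (E i)) ∧ (ObjectProperty.ofObj E).IsSeparating

variable (A) in
/-- `A` is locally noetherian: it has a small generating set of noetherian objects. -/
def IsLocallyNoetherianCat : Prop :=
  GeneratedBySmallSetOf (isNoetherianObject (C := A))

end Subcategories

/-! ### Group actions up to isomorphism -/

/-- A group homomorphism from `G` to the group of isomorphism classes of autoequivalences of `A`,
given by representatives of the classes (no coherence is imposed on the isomorphisms). -/
structure WeakAction (G : Type w) [Group G] (A : Type u) [Category.{v} A] where
  /-- a representative of the class of autoequivalences attached to `g` -/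
  act : G → (A ≌ A)
  act_one : Nonempty ((act 1).functor ≅ 𝟭 A)
  act_mul : ∀ g h : G, Nonempty ((act (g * h)).functor ≅ (act h).functor ⋙ (act g).functor)

namespace WeakAction

variable {G : Type w} [Group G] {A : Type u} [Category.{v} A]

/-- `P` is `G`-closed: `g · X` lies in `P` for all `g` in `G` and `X` in `P`. -/
def IsClosed (ρ : WeakAction G A) (P : ObjectProperty A) : Prop :=
  ∀ (g : G) (X : A), P X → P ((ρ.act g).functor.obj X)

/-- The restriction of an action to a subgroup. -/
def restrict (ρ : WeakAction G A) (H : Subgroup G) : WeakAction H A where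
  act h := ρ.act h
  act_one := ρ.act_one
  act_mul g h := ρ.act_mul g h

end WeakAction

/-! ### Symmetric monoidal categories -/

section Monoidal

variable {A : Type u} [Category.{v} A] [MonoidalCategory A]

/-- `L` is invertible: `L ⊗ M ≅ 𝟙_ A` for some `M`. -/
def IsInvertibleObj (L : A) : Prop :=
  ∃ M : A, Nonempty (L ⊗ M ≅ 𝟙_ A)

/-- `D` is dualizable: it has a dual `E`, with unit `𝟙_ A ⟶ D ⊗ E` and counit `E ⊗ D ⟶ 𝟙_ A`
satisfying the triangle identities. -/
def IsDualizableObj (D : A) : Prop :=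
  ∃ E : A, Nonempty (ExactPairing D E)

/-- `P` is a tensor ideal. -/
def IsTensorIdeal (P : ObjectProperty A) : Prop :=
  ∀ X M : A, P X → P (X ⊗ M)

/-- `P` is L-closed: closed under tensoring with invertible objects. -/
def IsLClosed (P : ObjectProperty A) : Prop :=
  ∀ X L : A, P X → IsInvertibleObj L → P (X ⊗ L)

variable (A) in
/-- The unit object is finitely presented. -/
def CondC1 : Prop :=
  IsFinitelyPresentable.{v} (𝟙_ A)

variable (A) in
/-- `A` is generated by a small set of dualizable objects. -/
def CondC2 [Abelian A] : Prop :=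
  GeneratedBySmallSetOf (IsDualizableObj : ObjectProperty A)

variable (A) in
/-- The Picard group: isomorphism classes of invertible objects under the tensor product, as the
units of the monoid of isomorphism classes of objects. -/
abbrev Pic : Type u := (Skeleton A)ˣ

/-- An object in the isomorphism class `L`. -/
noncomputable def Pic.rep (L : Pic A) : A := (L : Skeleton A).out

lemma Pic.toSkeleton_rep (L : Pic A) : toSkeleton L.rep = (L : Skeleton A) :=
  Quotient.out_eq _

lemma Pic.nonempty_rep_one : Nonempty ((1 : Pic A).rep ≅ 𝟙_ A) :=
  Quotient.exact ((1 : Pic A).toSkeleton_rep.trans Skeleton.one_eq)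

lemma Pic.nonempty_rep_mul (L M : Pic A) : Nonempty ((L * M).rep ≅ L.rep ⊗ M.rep) :=
  Quotient.exact ((L * M).toSkeleton_rep.trans (Skeleton.mul_eq _ _))

variable [SymmetricCategory A]

/-- `X ↦ X ⊗ L` as an autoequivalence, for `L` in the Picard group. -/
noncomputable def Pic.tensorEquiv (L : Pic A) : A ≌ A :=
  have h₁ : Nonempty (L.rep ⊗ (L⁻¹).rep ≅ 𝟙_ A) := by
    obtain ⟨e⟩ := Pic.nonempty_rep_mul L L⁻¹
    obtain ⟨f⟩ := Pic.nonempty_rep_one (A := A)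
    rw [mul_inv_cancel] at e
    exact ⟨e.symm ≪≫ f⟩
  have h₂ : Nonempty ((L⁻¹).rep ⊗ L.rep ≅ 𝟙_ A) := ⟨β_ _ _ ≪≫ h₁.some⟩
  CategoryTheory.Equivalence.mk (tensorRight L.rep) (tensorRight (L⁻¹).rep)
    ((NatIso.ofComponents (fun X => ρ_ X) : tensorRight (𝟙_ A) ≅ 𝟭 A).symm ≪≫
      (tensoringRight A).mapIso h₁.some.symm ≪≫ tensorRightTensor _ _)
    ((tensorRightTensor _ _).symm ≪≫ (tensoringRight A).mapIso h₂.some ≪≫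
      (NatIso.ofComponents (fun X => ρ_ X) : tensorRight (𝟙_ A) ≅ 𝟭 A))

variable (A) in
/-- The action of the Picard group on `A` by tensor product. -/
noncomputable def picAction : WeakAction (Pic A) A where
  act := Pic.tensorEquiv
  act_one := ⟨(tensoringRight A).mapIso Pic.nonempty_rep_one.some ≪≫
    NatIso.ofComponents (fun X => ρ_ X)⟩
  act_mul g h := ⟨(tensoringRight A).mapIso
      ((Pic.nonempty_rep_mul g h).some ≪≫ β_ _ _) ≪≫ tensorRightTensor h.rep g.rep⟩

/-- The objects isomorphic to a tensor power `L^{⊗ n}`, for `L` in the set `𝓛` of (classes of)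
invertible objects and an integer `n`. -/
def tensorPowers (𝓛 : Set (Pic A)) : ObjectProperty A :=
  fun M => ∃ L ∈ 𝓛, ∃ n : ℤ, toSkeleton M = ((L ^ n : Pic A) : Skeleton A)

end Monoidal

/-! ### Sets of tensor ideals and of `G`-closed subcategories

A subcategory of `𝒜_noeth` is an `ObjectProperty A` contained in `isNoetherianObject`.  As
`𝒜_noeth` is closed in `𝒜` under subobjects, quotients and extensions, exactness, kernels,
cokernels and images in `𝒜_noeth` are those of `𝒜`, and the closure properties above, applied to
such a property, are the closure properties in `𝒜_noeth`. -/

section Sets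

variable (A : Type u) [Category.{v} A] [Abelian A]

/-- Localizing subcategories of `A` that are tensor ideals. -/
def tensorLoc [HasCoproducts.{v} A] [MonoidalCategory A] : Set (ObjectProperty A) :=
  {P | IsLocalizingSubcat P ∧ IsTensorIdeal P}

/-- Torsion classes of the category of noetherian objects that are tensor ideals there. -/
def tensorTorsNoeth [MonoidalCategory A] : Set (ObjectProperty A) :=
  {P | P ≤ isNoetherianObject ∧ IsTorsionClass P ∧
    ∀ X M : A, P X → isNoetherianObject M → P (X ⊗ M)}

variable {A} {G : Type w} [Group G]

/-- `G`-closed localizing subcategories of `A`. -/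
def WeakAction.loc [HasCoproducts.{v} A] (ρ : WeakAction G A) : Set (ObjectProperty A) :=
  {P | IsLocalizingSubcat P ∧ ρ.IsClosed P}

/-- `G`-closed torsion classes of the category of noetherian objects. -/
def WeakAction.torsNoeth (ρ : WeakAction G A) : Set (ObjectProperty A) :=
  {P | P ≤ isNoetherianObject ∧ IsTorsionClass P ∧ ρ.IsClosed P}

end Sets

/-! The heart is `isSerreClass_of_mem_tensorTorsNoeth`: if tensor ideal and G-closed torsion classes
of noetherian objects agree, each such class T is Serre. Otherwise, dividing by a T-radical gives M
in T with a subobject N receiving no nonzero map from T. As the unit is noetherian, N can be shrunk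
until all its nonzero subobjects have the same annihilator. The noetherian objects killed by an
ideal not killing N form a Serre tensor ideal S, which misses M. A minimal quotient Q of M outside S
has all proper quotients in S, so the objects filtered by S and by subobjects of translates of Q
form a G-closed torsion class, hence a tensor ideal. It contains Q ⊗ E for E dualizable, which
produces a nonzero map N ⊗ Z ⟶ N with Z in S or inside a translate of Q. In both cases an ideal not
killing N kills a nonzero subobject of N, a contradiction (`IsPrimeObj.false_of_torsion`).

For (I), the torsion class generated by a G-closed X, namely `Filtered (quotientsOf X)`, is
therefore Serre. Kernels of quotients of objects of X, and subobjects of objects of X, are thus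
filtered by quotients of objects of X; induction on the filtration settles the CE and IE cases.

For (II), an extension of an invertible object by a dualizable one is dualizable, which gives (C2);
the tensor ideal property is checked on tensor powers and spreads through extensions, quotients and
coproducts. (III) takes all of the Picard group for `𝓛`. -/

section ShortExactSequences

variable {A : Type u} [Category.{v} A] [Abelian A]

lemma shortExact_image {X Y : A} (f : X ⟶ Y) :
    (ShortComplex.mk (kernel.ι f) (factorThruImage f)
      (by rw [← cancel_mono (image.ι f)]; simp)).ShortExact where
  exact := ShortComplex.exact_of_f_is_kernel _ <| by
    refine KernelFork.IsLimit.ofι _ _ (fun {W} g hg => kernel.lift f g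
      (by rw [← image.fac f, ← Category.assoc, hg, zero_comp])) ?_ ?_
    · intros; exact kernel.lift_ι _ _ _
    · intro W g hg m hm
      simp [← cancel_mono (kernel.ι f), hm]
  mono_f := inferInstance
  epi_g := inferInstance

lemma shortExact_cokernel {X Y : A} (f : X ⟶ Y) [Mono f] :
    (ShortComplex.mk f (cokernel.π f) (cokernel.condition f)).ShortExact where
  exact := ShortComplex.exact_cokernel f
  mono_f := ‹_›
  epi_g := inferInstance

lemma shortExact_kernel {X Y : A} (f : X ⟶ Y) [Epi f] :
    (ShortComplex.mk (kernel.ι f) f (kernel.condition f)).ShortExact where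
  exact := ShortComplex.exact_kernel f
  mono_f := inferInstance
  epi_g := ‹_›

lemma shortExact_pullback {S : ShortComplex A} (hS : S.ShortExact) {Z : A} (h : Z ⟶ S.X₃) :
    (ShortComplex.mk (pullback.lift S.f 0 (by simp) : S.X₁ ⟶ pullback S.g h)
      (pullback.snd S.g h) (pullback.lift_snd _ _ _)).ShortExact where
  exact := by
    rw [ShortComplex.exact_iff_exact_up_to_refinements]
    intro T x hx
    dsimp at x hx
    obtain ⟨T', π, hπ, y, hy⟩ := hS.exact.exact_up_to_refinements (x ≫ pullback.fst S.g h)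
      (by rw [Category.assoc, pullback.condition, ← Category.assoc, hx, zero_comp])
    refine ⟨T', π, hπ, y, ?_⟩
    apply pullback.hom_ext
    · rw [Category.assoc, Category.assoc, pullback.lift_fst, hy]
    · rw [Category.assoc, hx, Category.assoc, pullback.lift_snd, comp_zero, comp_zero]
  mono_f := by
    have := hS.mono_f
    exact mono_of_mono_fac (pullback.lift_fst S.f 0 (by simp) : _ ≫ pullback.fst S.g h = S.f)
  epi_g := by
    have := hS.epi_g
    dsimp
    infer_instance

lemma shortExact_pullback_fst {S : ShortComplex A} {Q : ShortComplex A}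
    (hQ : Q.ShortExact) (g : S.X₂ ⟶ Q.X₂) [Epi g] :
    (ShortComplex.mk (pullback.fst g Q.f) (g ≫ Q.g)
      (by rw [pullback.condition_assoc, Q.zero, comp_zero])).ShortExact where
  exact := by
    rw [ShortComplex.exact_iff_exact_up_to_refinements]
    intro T x hx
    dsimp at x hx
    obtain ⟨T', π, hπ, y, hy⟩ := hQ.exact.exact_up_to_refinements (x ≫ g)
      (by rw [Category.assoc, hx])
    exact ⟨T', π, hπ, pullback.lift (π ≫ x) y (by simpa using hy), (pullback.lift_fst _ _ _).symm⟩
  mono_f := by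
    have := hQ.mono_f
    dsimp
    infer_instance
  epi_g := by
    have := hQ.epi_g
    dsimp
    infer_instance

end ShortExactSequences

/-! ### Noetherian objects form a Serre class. -/

section Noetherian

variable {A : Type u} [Category.{v} A] [Abelian A]

lemma Subobject.le_iff_comp_cokernel_eq_zero {X : A} (a b : Subobject X) :
    a ≤ b ↔ a.arrow ≫ cokernel.π b.arrow = 0 := by
  refine ⟨fun h => ?_, fun h => ?_⟩
  · rw [← Subobject.ofLE_arrow h, Category.assoc, cokernel.condition, comp_zero]
  · exact Subobject.le_of_comm (Abelian.monoLift b.arrow a.arrow h)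
      (Abelian.monoLift_comp _ _ _)

lemma isNoetherianObject_of_epi {X Y : A} (f : X ⟶ Y) [Epi f] (hX : isNoetherianObject X) :
    isNoetherianObject Y := by
  have : WellFoundedGT (Subobject X) := hX
  have h : StrictMono (Subobject.pullback f).obj := by
    refine (Subobject.pullback f).monotone.strictMono_of_injective ?_
    suffices ∀ a b : Subobject Y, (Subobject.pullback f).obj a ≤ (Subobject.pullback f).obj b →
        a ≤ b from fun a b hab => le_antisymm (this _ _ hab.le) (this _ _ hab.ge)
    intro a b hab
    have : Epi (Subobject.pullbackπ f a) := by
      rw [← (Subobject.isPullback f a).isoPullback_hom_fst]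
      infer_instance
    rw [Subobject.le_iff_comp_cokernel_eq_zero, ← cancel_epi (Subobject.pullbackπ f a),
      ← Category.assoc, (Subobject.isPullback f a).w, ← Subobject.ofLE_arrow hab, Category.assoc,
      Category.assoc, ← reassoc_of% (Subobject.isPullback f b).w, cokernel.condition]
    simp
  exact h.wellFoundedGT

/-- Nested subobjects of `S.X₂` with the same trace on `S.X₁` and the same image in `S.X₃` are
equal, so `φ` is strictly monotone. -/
lemma isNoetherianObject_of_shortExact {S : ShortComplex A} (hS : S.ShortExact)
    (h₁ : isNoetherianObject S.X₁) (h₃ : isNoetherianObject S.X₃) :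
    isNoetherianObject S.X₂ := by
  have : WellFoundedGT (Subobject S.X₁) := h₁
  have : WellFoundedGT (Subobject S.X₃) := h₃
  let φ : Subobject S.X₂ → Subobject S.X₁ × Subobject S.X₃ := fun a =>
    ((Subobject.pullback S.f).obj a, imageSubobject (a.arrow ≫ S.g))
  have hφ : Monotone φ := fun a b hab =>
    ⟨(Subobject.pullback S.f).monotone hab, imageSubobject_le_mk _ _
      (Subobject.ofLE a b hab ≫ factorThruImage (b.arrow ≫ S.g)) (by simp)⟩
  have : StrictMono φ := by
    intro a b hab
    refine lt_of_le_of_ne (hφ hab.le) fun h => hab.not_ge ?_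
    rw [Subobject.le_iff_comp_cokernel_eq_zero]
    have h₁ : (Subobject.pullback S.f).obj a = (Subobject.pullback S.f).obj b :=
      congrArg Prod.fst h
    have h₂ : imageSubobject (a.arrow ≫ S.g) = imageSubobject (b.arrow ≫ S.g) :=
      congrArg Prod.snd h
    obtain ⟨T, π, hπ, x, hx⟩ := surjective_up_to_refinements_of_epi
      (factorThruImageSubobject (a.arrow ≫ S.g))
      (factorThruImageSubobject (b.arrow ≫ S.g) ≫ Subobject.ofLE _ _ h₂.ge)
    have hx' : π ≫ b.arrow ≫ S.g = x ≫ a.arrow ≫ S.g := by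
      simpa using hx =≫ (imageSubobject (a.arrow ≫ S.g)).arrow
    obtain ⟨T', π', hπ', y, hy⟩ := hS.exact.exact_up_to_refinements
      (π ≫ b.arrow - x ≫ a.arrow) (by simp [hx'])
    have hy' : π' ≫ (π ≫ b.arrow - x ≫ a.arrow) =
        (π' ≫ (π - x ≫ Subobject.ofLE a b hab.le)) ≫ b.arrow := by simp
    have hz : y ≫ S.f ≫ cokernel.π a.arrow = 0 := by
      have e := (Subobject.isPullback S.f b).lift_snd _ y (hy'.symm.trans hy)
      have e' : ((Subobject.pullback S.f).obj b).arrow ≫ S.f ≫ cokernel.π a.arrow = 0 := by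
        rw [← Subobject.ofLE_arrow h₁.ge, Category.assoc,
          ← reassoc_of% (Subobject.isPullback S.f a).w, cokernel.condition, comp_zero, comp_zero]
      have e'' := (Subobject.isPullback S.f b).lift _ _ (hy'.symm.trans hy) ≫= e'
      rwa [reassoc_of% e, comp_zero] at e''
    have e := hy =≫ cokernel.π a.arrow
    rw [Category.assoc, Category.assoc, hz] at e
    rw [← cancel_epi π, ← cancel_epi π']
    simpa using e
  exact this.wellFoundedGT

instance : (isNoetherianObject (C := A)).IsSerreClass where
  prop_of_epi f _ := isNoetherianObject_of_epi f
  prop_X₂_of_shortExact hS := isNoetherianObject_of_shortExact hS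

end Noetherian

/-! ### Filtered objects and generated torsion classes. -/

section Filtered

variable {A : Type u} [Category.{v} A] [Abelian A] {P : ObjectProperty A}

namespace Filtered

open ZeroObject

lemma of_iso {X Y : A} (e : X ≅ Y) (hX : Filtered P X) : Filtered P Y := by
  cases hX with
  | zero _ hX => exact .zero Y (hX.of_iso e.symm)
  | step S hS h₁ h₃ =>
    exact .step (ShortComplex.mk (S.f ≫ e.hom) (e.inv ≫ S.g) (by simp))
      (ShortComplex.shortExact_of_iso (S₁ := S)
        (ShortComplex.isoMk (Iso.refl _) e (Iso.refl _) (by simp) (by simp)) hS) h₁ h₃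

instance : (Filtered P).IsClosedUnderIsomorphisms := ⟨of_iso⟩

instance : (Filtered P).ContainsZero := ⟨0, isZero_zero _, .zero _ (isZero_zero _)⟩

lemma of_prop {X : A} (hX : P X) : Filtered P X :=
  .step (ShortComplex.mk (0 : 0 ⟶ X) (𝟙 X) (by simp))
    { exact := (ShortComplex.exact_iff_mono _ rfl).2 inferInstance
      mono_f := ⟨fun _ _ _ => (isZero_zero A).eq_of_tgt _ _⟩
      epi_g := by dsimp; infer_instance } (.zero _ (isZero_zero _)) hX

/-- Induction on the filtration of the quotient: the preimage of its penultimate layer is filtered,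
and the top subquotient is unchanged. -/
lemma extension {X₃ : A} (h₃ : Filtered P X₃) :
    ∀ {X₁ X₂ : A} (f : X₁ ⟶ X₂) (g : X₂ ⟶ X₃) (w : f ≫ g = 0),
      (ShortComplex.mk f g w).ShortExact → Filtered P X₁ → Filtered P X₂ := by
  induction h₃ with
  | zero X hX =>
    intro X₁ X₂ f g w hS h₁
    have := hS.isIso_f_iff.2 hX
    exact h₁.of_iso (asIso f)
  | step Q hQ h₁ h₃ ih =>
    intro X₁ X₂ f g w hS h
    have := hS.epi_g
    exact .step _ (shortExact_pullback_fst (S := ShortComplex.mk f g w) hQ g)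
      (ih _ _ _ (shortExact_pullback hS Q.f) h) h₃

instance : (Filtered P).IsClosedUnderExtensions where
  prop_X₂_of_shortExact {S} hS h₁ h₃ := h₃.extension S.f S.g S.zero hS h₁

lemma of_epi [P.IsClosedUnderQuotients] {X : A} (hX : Filtered P X) :
    ∀ {Y : A} (q : X ⟶ Y) [Epi q], Filtered P Y := by
  induction hX with
  | zero X hX => exact fun q _ => .zero _ (hX.of_epi q)
  | step S hS h₁ h₃ ih =>
    intro Y q _
    have := hS.epi_g
    let r : S.X₃ ⟶ cokernel (image.ι (S.f ≫ q)) := hS.exact.desc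
      (q ≫ cokernel.π _) (by
        rw [← Category.assoc]
        have := factorThruImage (S.f ≫ q) ≫= cokernel.condition (image.ι (S.f ≫ q))
        rwa [image.fac_assoc, comp_zero] at this)
    have : Epi r := epi_of_epi_fac (hS.exact.g_desc _ _ : S.g ≫ r = q ≫ cokernel.π _)
    exact .step _ (shortExact_cokernel (image.ι (S.f ≫ q)))
      (ih (factorThruImage (S.f ≫ q))) (P.prop_of_epi r h₃)

instance [P.IsClosedUnderQuotients] : (Filtered P).IsClosedUnderQuotients where
  prop_of_epi q _ h := h.of_epi q

lemma of_mono [P.IsClosedUnderSubobjects] {X : A} (hX : Filtered P X) :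
    ∀ {Y : A} (i : Y ⟶ X) [Mono i], Filtered P Y := by
  induction hX with
  | zero X hX => exact fun i _ => .zero _ (hX.of_mono i)
  | step S hS h₁ h₃ ih =>
    intro Y i _
    have := hS.mono_f
    let r : kernel (i ≫ S.g) ⟶ S.X₁ := hS.exact.lift (kernel.ι (i ≫ S.g) ≫ i) (by simp)
    have : Mono r := mono_of_mono_fac (hS.exact.lift_f _ _ : r ≫ S.f = kernel.ι (i ≫ S.g) ≫ i)
    exact .step _ (shortExact_image (i ≫ S.g)) (ih r) (P.prop_of_mono (image.ι (i ≫ S.g)) h₃)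

instance [P.IsClosedUnderSubobjects] : (Filtered P).IsClosedUnderSubobjects where
  prop_of_mono i _ h := h.of_mono i

lemma le_of_le {Q : ObjectProperty A} [Q.ContainsZero] [Q.IsClosedUnderIsomorphisms]
    [Q.IsClosedUnderExtensions] (h : P ≤ Q) : Filtered P ≤ Q := by
  intro X hX
  induction hX with
  | zero X hX => exact Q.prop_of_isZero hX
  | step S hS h₁ h₃ ih => exact Q.prop_X₂_of_shortExact hS ih (h _ h₃)

lemma map {B : Type*} [Category B] [Abelian B] (F : A ⥤ B) [F.PreservesZeroMorphisms]
    [PreservesFiniteLimits F] [PreservesFiniteColimits F]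
    {Q : ObjectProperty B} (h : ∀ X, P X → Q (F.obj X)) {X : A} (hX : Filtered P X) :
    Filtered Q (F.obj X) := by
  induction hX with
  | zero X hX => exact .zero _ (F.map_isZero hX)
  | step S hS h₁ h₃ ih =>
    have := hS.mono_f
    have := hS.epi_g
    exact .step _ (hS.map F) ih (h _ h₃)

lemma exists_mono_ne_zero {X : A} (hX : Filtered P X) (h : ¬ IsZero X) :
    ∃ (Z : A) (i : Z ⟶ X), Mono i ∧ ¬ IsZero Z ∧ ∃ Z', P Z' ∧ Nonempty (Z ≅ Z') := by
  induction hX with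
  | zero X hX => exact (h hX).elim
  | step S hS h₁ h₃ ih =>
    by_cases h0 : IsZero S.X₁
    · have := hS.isIso_g_iff.2 h0
      exact ⟨_, 𝟙 _, inferInstance, h, S.X₃, h₃, ⟨asIso S.g⟩⟩
    · obtain ⟨Z, i, hi, hZ, hZ'⟩ := ih h0
      have := hS.mono_f
      exact ⟨Z, i ≫ S.f, inferInstance, hZ, hZ'⟩

end Filtered

/-- The quotients of objects of `P`. -/
def quotientsOf (P : ObjectProperty A) : ObjectProperty A :=
  fun Y => ∃ (X : A) (p : X ⟶ Y), P X ∧ Epi p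

instance : (quotientsOf P).IsClosedUnderQuotients where
  prop_of_epi q _ := fun ⟨X, p, hX, _⟩ => ⟨X, p ≫ q, hX, inferInstance⟩

omit [Abelian A] in
lemma le_quotientsOf : P ≤ quotientsOf P := fun X hX => ⟨X, 𝟙 X, hX, inferInstance⟩

/-- This is the torsion class generated by `P`. -/
lemma isTorsionClass_filtered_quotientsOf : IsTorsionClass (Filtered (quotientsOf P)) where
  containsZero := inferInstance
  quotients := inferInstance
  extensions := inferInstance

/-- If `P` is closed under cokernels, then so it is under quotients by subobjects filtered by
quotients of objects of `P`. -/
lemma prop_of_shortExact_of_filtered_quotientsOf [P.IsClosedUnderCokernels] {K : A}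
    (hK : Filtered (quotientsOf P) K) :
    ∀ {X Y : A} (f : K ⟶ X) (g : X ⟶ Y) (w : f ≫ g = 0),
      (ShortComplex.mk f g w).ShortExact → P X → P Y := by
  induction hK with
  | zero K hK =>
    intro X Y f g w hS hX
    have : IsIso g := hS.isIso_g_iff.2 hK
    -- `Y` is presented as a cokernel of `0 : X ⟶ X`, so closure under cokernels suffices.
    exact P.prop_of_isColimit_cokernelCofork (f := (0 : X ⟶ X))
      (CokernelCofork.IsColimit.ofπ g (by simp) (fun k _ => inv g ≫ k) (by simp)
        (fun k _ m hm => by simp [← hm])) hX hX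
  | step S hS h₁ h₃ ih =>
    intro X Y f g w hQ hX
    have := hS.mono_f
    have := hS.epi_g
    have : Mono f := hQ.mono_f
    have : Epi g := hQ.epi_g
    obtain ⟨X', p, hX', hp⟩ := h₃
    let r : S.X₃ ⟶ cokernel (S.f ≫ f) := hS.exact.desc (f ≫ cokernel.π (S.f ≫ f))
      (by rw [← Category.assoc, cokernel.condition])
    have hr : S.g ≫ r = f ≫ cokernel.π (S.f ≫ f) := hS.exact.g_desc _ _
    -- `Y` is the cokernel of `p ≫ r : X' ⟶ X / S.X₁`, whose target lies in `P` by induction.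
    refine P.prop_of_isColimit_cokernelCofork (f := p ≫ r)
      (CokernelCofork.IsColimit.ofπ (cokernel.desc (S.f ≫ f) g (by simp [w])) ?_
        (fun k hk => hQ.exact.desc (cokernel.π (S.f ≫ f) ≫ k) ?_)
        (fun k hk => ?_) (fun k hk m hm => ?_)) hX'
      (ih _ _ _ (shortExact_cokernel (S.f ≫ f)) hX)
    · have : r ≫ cokernel.desc (S.f ≫ f) g (by simp [w]) = 0 := by
        rw [← cancel_epi S.g, ← Category.assoc, hr, Category.assoc, cokernel.π_desc, w, comp_zero]
      rw [Category.assoc, this, comp_zero]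
    · rw [Category.assoc, ← comp_zero (f := p), cancel_epi] at hk
      dsimp
      rw [← Category.assoc, ← hr, Category.assoc, hk, comp_zero]
    · rw [← cancel_epi (cokernel.π (S.f ≫ f)), cokernel.π_desc_assoc]
      exact hQ.exact.g_desc _ _
    · subst hm
      rw [← cancel_epi g]
      refine Eq.trans ?_ (hQ.exact.g_desc _ _).symm
      simp

end Filtered

/-! ### From Serre torsion classes to the two lists of equivalences. -/

section Equivalences

variable {A : Type u} [Category.{v} A] [Abelian A] {P : ObjectProperty A}

lemma IsCEClosed.isTorsionClass (hP : IsCEClosed P)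
    (h : (Filtered (quotientsOf P)).IsSerreClass) : IsTorsionClass P where
  containsZero := hP.containsZero
  extensions := hP.extensions
  quotients := ⟨fun {X Y} f _ hX => by
    have := hP.cokernels
    exact prop_of_shortExact_of_filtered_quotientsOf
      ((Filtered (quotientsOf P)).prop_of_mono (kernel.ι f) (.of_prop (le_quotientsOf _ hX)))
      _ _ _ (shortExact_kernel f) hX⟩

/-- If `P` is closed under images and extensions, then an object filtered by quotients of objects
of `P` which embeds into an object of `P` lies in `P`. -/
lemma IsIEClosed.prop_of_mono [P.IsClosedUnderIsomorphisms] (hP : IsIEClosed P) {M : A}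
    (hM : Filtered (quotientsOf P) M) :
    ∀ {X : A} (i : M ⟶ X) [Mono i], P X → P M := by
  have := hP.containsZero
  have := hP.extensions
  induction hM with
  | zero M hM => exact fun _ _ _ => P.prop_of_isZero hM
  | step S hS h₁ h₃ ih =>
    intro X i _ hX
    have := hS.mono_f
    have := hS.epi_g
    obtain ⟨X', p, hX', hp⟩ := h₃
    have : StrongEpi (pullback.fst S.g p) := strongEpi_of_epi _
    -- The pullback along `p` is an extension of `X'` by `S.X₁`. It surjects onto `S.X₂`, which
    -- becomes the image of a morphism between objects of `P`.
    have h := P.prop_X₂_of_shortExact (shortExact_pullback hS p) (ih (S.f ≫ i) hX) hX'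
    exact P.prop_of_iso (image.isoStrongEpiMono (pullback.fst S.g p) i rfl).symm
      (hP.images (pullback.fst S.g p ≫ i) h hX)

lemma IsIEClosed.isTorsionFreeClass [P.IsClosedUnderIsomorphisms] (hP : IsIEClosed P)
    (h : (Filtered (quotientsOf P)).IsSerreClass) : IsTorsionFreeClass P where
  containsZero := hP.containsZero
  extensions := hP.extensions
  subobjects := ⟨fun f _ hY => hP.prop_of_mono
    ((Filtered (quotientsOf P)).prop_of_mono f (.of_prop (le_quotientsOf _ hY))) f hY⟩

lemma tfae_isSerreClass [P.IsClosedUnderIsomorphisms]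
    (h : ∀ Q : ObjectProperty A, Q = P ∨ Q = Filtered (quotientsOf P) → IsTorsionClass Q →
      Q.IsSerreClass) :
    [P.IsSerreClass, IsTorsionClass P, IsWide P, IsICEClosed P, IsCEClosed P].TFAE := by
  have images [P.IsClosedUnderQuotients] : IsClosedUnderImages P :=
    fun X Y f hX hY => P.prop_of_epi (factorThruImage f) hX
  tfae_have 1 → 2 := fun h => ⟨inferInstance, inferInstance, inferInstance⟩
  tfae_have 1 → 3 := fun h => ⟨inferInstance, inferInstance, inferInstance, inferInstance⟩
  tfae_have 2 → 4 := fun h => by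
    have := h.quotients
    exact ⟨h.containsZero, images, inferInstance, h.extensions⟩
  tfae_have 3 → 4 := fun h => ⟨h.containsZero, fun X Y f hX hY => by
    have := h.cokernels
    have := h.kernels
    exact P.prop_of_iso (Abelian.imageIsoImage f)
      (P.prop_kernel _ hY (P.prop_cokernel f hX hY)), h.cokernels, h.extensions⟩
  tfae_have 4 → 5 := fun h => ⟨h.containsZero, h.cokernels, h.extensions⟩
  tfae_have 5 → 1 := fun hP => h _ (.inl rfl)
    (hP.isTorsionClass (h _ (.inr rfl) isTorsionClass_filtered_quotientsOf))
  tfae_finish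

lemma tfae_isTorsionFreeClass [P.IsClosedUnderIsomorphisms]
    (h : (Filtered (quotientsOf P)).IsSerreClass) :
    [IsTorsionFreeClass P, IsIKEClosed P, IsIEClosed P].TFAE := by
  tfae_have 1 → 2 := fun h => by
    have := h.subobjects
    exact ⟨h.containsZero, fun X Y f hX hY => P.prop_of_mono (image.ι f) hY, inferInstance,
      h.extensions⟩
  tfae_have 2 → 3 := fun h => ⟨h.containsZero, h.images, h.extensions⟩
  tfae_have 3 → 1 := fun hP => hP.isTorsionFreeClass h
  tfae_finish

end Equivalences

/-! ### Torsion radicals and minimal quotients. -/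

section Subobjects

variable {A : Type u} [Category.{v} A] [Abelian A]

lemma isNoetherianObject_sup {X : A} {a b : Subobject X}
    (ha : isNoetherianObject (a : A)) (hb : isNoetherianObject (b : A)) :
    isNoetherianObject ((a ⊔ b : Subobject X) : A) := by
  let d : (a : A) ⊞ (b : A) ⟶ X := biprod.desc a.arrow b.arrow
  have h : a ⊔ b ≤ Subobject.mk (image.ι d) := sup_le
    (Subobject.le_mk_of_comm (biprod.inl ≫ factorThruImage d) (by simp [d]))
    (Subobject.le_mk_of_comm (biprod.inr ≫ factorThruImage d) (by simp [d]))
  exact isNoetherianObject.prop_of_mono (Subobject.ofLEMk _ _ h)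
    (isNoetherianObject.prop_of_epi (factorThruImage d) (isNoetherianObject.prop_biprod ha hb))

/-- The largest subobject of a noetherian object lying in a torsion class. -/
lemma IsTorsionClass.exists_radical {P : ObjectProperty A} (hP : IsTorsionClass P) {M : A}
    (hM : isNoetherianObject M) :
    ∃ (T : A) (t : T ⟶ M), Mono t ∧ P T ∧ ∀ ⦃Z : A⦄ (f : Z ⟶ cokernel t), P Z → f = 0 := by
  have := hP.containsZero
  have := hP.quotients
  have := hP.extensions
  have : WellFoundedGT (Subobject M) := hM
  obtain ⟨t, ht, ht'⟩ := WellFounded.has_min (wellFounded_gt (α := Subobject M))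
    {t | P (t : A)} ⟨⊥, P.prop_of_isZero ((isZero_zero A).of_iso Subobject.botCoeIsoZero)⟩
  refine ⟨t, t.arrow, inferInstance, ht, fun Z f hZ => ?_⟩
  have hi : P (image f) := P.prop_of_epi (factorThruImage f) hZ
  -- The preimage of `image f` in `M` is an extension of it by `t`, so maximality of `t` forces the
  -- image to vanish.
  have hS := shortExact_pullback (shortExact_cokernel t.arrow) (image.ι f)
  have hQ := P.prop_X₂_of_shortExact hS ht hi
  dsimp at hQ
  let s : Subobject M := Subobject.mk (pullback.fst (cokernel.π t.arrow) (image.ι f))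
  have hts : t ≤ s := Subobject.le_mk_of_comm (pullback.lift t.arrow 0 (by simp))
    (pullback.lift_fst _ _ _)
  have hs : P (s : A) := P.prop_of_iso (Subobject.underlyingIso _).symm hQ
  have hst : s ≤ t := by
    by_contra h
    exact ht' s hs (lt_of_le_not_ge hts h)
  have h0 := (Subobject.le_iff_comp_cokernel_eq_zero _ _).1 hst
  have h1 : pullback.fst (cokernel.π t.arrow) (image.ι f) ≫ cokernel.π t.arrow = 0 := by
    rw [← Subobject.underlyingIso_arrow (pullback.fst (cokernel.π t.arrow) (image.ι f)),
      Category.assoc, h0, comp_zero]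
  rw [pullback.condition, ← comp_zero (f := pullback.snd (cokernel.π t.arrow) (image.ι f)),
    cancel_epi] at h1
  rw [← image.fac f, h1, comp_zero]

/-- A noetherian object belongs to every torsion class containing a generating set. -/
lemma IsTorsionClass.prop_of_isSeparating {P Q : ObjectProperty A} (hP : IsTorsionClass P)
    (hQ : Q.IsSeparating) (h : Q ≤ P) {M : A} (hM : isNoetherianObject M) : P M := by
  obtain ⟨T, t, _, hT, ht⟩ := hP.exists_radical hM
  have h0 : cokernel.π t = 0 := hQ _ _ fun G hG f => by
    rw [ht (f ≫ cokernel.π t) (h _ hG), comp_zero]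
  have := hP.quotients
  have : Epi t := Preadditive.epi_of_cokernel_zero h0
  exact P.prop_of_epi t hT

/-- A noetherian object satisfying `P` has a minimal quotient satisfying `P`. -/
lemma exists_minimal_quotient (P : ObjectProperty A) {M : A}
    (hM : isNoetherianObject M) (h : P M) :
    ∃ (Q : A) (q : M ⟶ Q), Epi q ∧ P Q ∧
      ∀ ⦃Y : A⦄ (p : Q ⟶ Y), Epi p → P Y → Mono p := by
  have : WellFoundedGT (Subobject M) := hM
  obtain ⟨_, ⟨Q, q, hq, hQ, rfl⟩, hmax⟩ := WellFounded.has_min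
    (wellFounded_gt (α := Subobject M))
    {t | ∃ (Q : A) (q : M ⟶ Q), Epi q ∧ P Q ∧ t = kernelSubobject q}
    ⟨_, M, 𝟙 M, inferInstance, h, rfl⟩
  refine ⟨Q, q, hq, hQ, fun Y p hp hY => Preadditive.mono_of_cancel_zero _ fun {T} x hx => ?_⟩
  have hle := hmax _ ⟨Y, q ≫ p, inferInstance, hY, rfl⟩
  obtain ⟨T', π, hπ, y, hy⟩ := surjective_up_to_refinements_of_epi q x
  have hy' : (kernelSubobject (q ≫ p)).Factors y := by
    rw [kernelSubobject_factors_iff, ← Category.assoc, ← hy, Category.assoc, hx, comp_zero]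
  have h₂ : kernelSubobject (q ≫ p) ≤ kernelSubobject q := by
    by_contra h'
    exact hle (lt_of_le_not_ge (le_kernelSubobject _ _ (by simp)) h')
  have := (kernelSubobject_factors_iff _ _).1 (Subobject.factors_of_le _ h₂ hy')
  rw [← cancel_epi π, hy, this, comp_zero]

end Subobjects

/-! ### Right exact functors and filtered colimits of noetherian objects. -/

section

variable {A : Type u} [Category.{v} A] [Abelian A]

/-- Injectivity of `S.f` is not needed because its image is a quotient of `S.X₁`; this is what makes
right exact functors such as tensor products harmless. -/
lemma IsTorsionClass.prop_X₂_of_exact {P : ObjectProperty A} (hP : IsTorsionClass P)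
    {S : ShortComplex A} (hS : S.Exact) [Epi S.g] (h₁ : P S.X₁) (h₃ : P S.X₃) : P S.X₂ := by
  have := hP.quotients
  have := hP.extensions
  have w : image.ι S.f ≫ S.g = 0 := by
    rw [← cancel_epi (factorThruImage S.f), image.fac_assoc, S.zero, comp_zero]
  have hS' : (ShortComplex.mk (image.ι S.f) S.g w).ShortExact :=
    { exact := by
        rw [ShortComplex.exact_iff_exact_up_to_refinements]
        intro T x hx
        obtain ⟨T', π, hπ, y, hy⟩ := hS.exact_up_to_refinements x hx
        exact ⟨T', π, hπ, y ≫ factorThruImage S.f, by simpa using hy⟩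
      mono_f := by dsimp; infer_instance
      epi_g := ‹_› }
  exact P.prop_X₂_of_shortExact (S := ShortComplex.mk (image.ι S.f) S.g w) hS'
    (P.prop_of_epi (factorThruImage S.f) h₁) h₃

/-- The preimage of a torsion class under a right exact functor is a torsion class. -/
lemma IsTorsionClass.inverseImage {P : ObjectProperty A} (hP : IsTorsionClass P)
    (F : A ⥤ A) [F.IsLeftAdjoint] : IsTorsionClass (P.inverseImage F) where
  containsZero := by
    obtain ⟨Z, hZ, _⟩ := hP.containsZero.exists_zero
    have := hP.containsZero
    have := hP.quotients
    exact ⟨Z, hZ, P.prop_of_isZero (F.map_isZero hZ)⟩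
  quotients := ⟨fun f _ hX => by
    have := hP.quotients
    exact P.prop_of_epi (F.map f) hX⟩
  extensions := ⟨fun {S} hS h₁ h₃ => by
    have := hS.epi_g
    have h : (S.map F).Exact := hS.exact.map_of_epi_of_preservesCokernel F inferInstance inferInstance
    have : Epi (S.map F).g := inferInstanceAs (Epi (F.map S.g))
    exact hP.prop_X₂_of_exact h h₁ h₃⟩

lemma isTorsionClass_isNoetherianObject : IsTorsionClass (isNoetherianObject (C := A)) :=
  ⟨inferInstance, inferInstance, inferInstance⟩

lemma Subobject.eq_top_of_isSeparating {P : ObjectProperty A} (hP : P.IsSeparating) {X : A}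
    (s : Subobject X) (h : ∀ ⦃G : A⦄ (g : G ⟶ X), P G → imageSubobject g ≤ s) : s = ⊤ := by
  have h0 : cokernel.π s.arrow = 0 := hP _ _ fun G hG g => by
    rw [← imageSubobject_arrow_comp g, ← Subobject.ofLE_arrow (h g hG), Category.assoc,
      Category.assoc, cokernel.condition, comp_zero, comp_zero, comp_zero]
  have : Epi s.arrow := Preadditive.epi_of_cokernel_zero h0
  have : IsIso s.arrow := isIso_of_mono_of_epi _
  exact Subobject.eq_top_of_isIso_arrow s

/-- Every object of a locally noetherian category is a filtered colimit of noetherian objects. -/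
lemma exists_filtered_isColimit_isNoetherianObject [IsGrothendieckAbelian.{v} A]
    (hA : IsLocallyNoetherianCat A) (X : A) :
    ∃ (J : Type v) (_ : SmallCategory J) (_ : IsFiltered J) (F : J ⥤ A)
      (ι : F ⟶ (Functor.const J).obj X),
      (∀ j, isNoetherianObject (F.obj j)) ∧ Nonempty (IsColimit (Cocone.mk X ι)) := by
  classical
  obtain ⟨ι, G, hG, hsep⟩ := hA
  let κ : Type v := Σ i, (G i ⟶ X)
  let φ : Finset κ → Subobject X := fun s => s.sup fun k => imageSubobject k.2
  have hφ : Monotone φ := fun s t h => Finset.sup_mono h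
  have hφnoeth (s : Finset κ) : isNoetherianObject (φ s : A) := by
    induction s using Finset.induction_on with
    | empty =>
      simp only [φ, Finset.sup_empty]
      exact isNoetherianObject.prop_of_isZero ((isZero_zero A).of_iso Subobject.botCoeIsoZero)
    | insert k s _ ih =>
      simp only [φ, Finset.sup_insert]
      exact isNoetherianObject_sup (isNoetherianObject.prop_of_epi
        (factorThruImageSubobject k.2) (hG _)) ih
  have htop : (⨆ s, φ s) = ⊤ := by
    refine Subobject.eq_top_of_isSeparating hsep _ ?_
    rintro _ g ⟨i⟩
    exact le_trans (by simp [φ]) (le_iSup φ {(⟨i, g⟩ : κ)})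
  let F : Finset κ ⥤ MonoOver X := hφ.functor ⋙ Subobject.representative
  let c : Cocone (F ⋙ MonoOver.forget X) := Cocone.mk (Over.mk (𝟙 X))
    { app s := Over.homMk (F.obj s).obj.hom
      naturality s t f := by
        ext
        exact (MonoOver.w (F.map f)).trans (Category.comp_id _).symm }
  have : Mono c.pt.hom := inferInstanceAs (Mono (𝟙 X))
  have hsup : (⨆ s, Subobject.mk (F.obj s).obj.hom) = ⊤ := by
    rw [← htop]
    exact iSup_congr fun s => Subobject.mk_arrow (φ s)
  -- By exactness of filtered colimits, a directed union equal to the whole object is a colimit.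
  have hc := IsGrothendieckAbelian.isColimitMapCoconeOfSubobjectMkEqISup F c (by
      rw [hsup, ← Subobject.isIso_iff_mk_eq_top]
      exact inferInstanceAs (IsIso (𝟙 X)))
  exact ⟨Finset κ, inferInstance, inferInstance, _, _, hφnoeth, ⟨hc⟩⟩

end

/-! ### Dualizable objects are noetherian. -/

section Dualizable

variable {A : Type u} [Category.{v} A] [MonoidalCategory A]

lemma IsDualizableObj.symm [SymmetricCategory A] {D E : A} [ExactPairing D E] : IsDualizableObj E :=
  ⟨D, ⟨BraidedCategory.exactPairing_swap D E⟩⟩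

lemma IsDualizableObj.tensor {D D' : A} (h : IsDualizableObj D) (h' : IsDualizableObj D') :
    IsDualizableObj (D ⊗ D') := by
  obtain ⟨E, ⟨_⟩⟩ := h
  obtain ⟨E', ⟨_⟩⟩ := h'
  exact ⟨E' ⊗ E, ⟨inferInstance⟩⟩

lemma isDualizableObj_unit : IsDualizableObj (𝟙_ A) := ⟨𝟙_ A, ⟨inferInstance⟩⟩

variable [Abelian A] [MonoidalClosed A]

lemma whiskerLeft_zero' (X : A) {Y Z : A} : X ◁ (0 : Y ⟶ Z) = 0 :=
  (tensorLeft X).map_zero Y Z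

instance epi_whiskerLeft' (X : A) {Y Z : A} (f : Y ⟶ Z) [Epi f] : Epi (X ◁ f) :=
  inferInstanceAs (Epi ((tensorLeft X).map f))

variable [SymmetricCategory A]

instance isLeftAdjoint_tensorRight (X : A) : (tensorRight X).IsLeftAdjoint :=
  Functor.isLeftAdjoint_of_iso (BraidedCategory.tensorLeftIsoTensorRight X)

lemma zero_whiskerRight' (X : A) {Y Z : A} : (0 : Y ⟶ Z) ▷ X = 0 :=
  (tensorRight X).map_zero Y Z

instance epi_whiskerRight' (X : A) {Y Z : A} (f : Y ⟶ Z) [Epi f] : Epi (f ▷ X) :=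
  inferInstanceAs (Epi ((tensorRight X).map f))

variable [IsGrothendieckAbelian.{v} A]

/-- If the unit object is finitely presented, then dualizable objects are noetherian. -/
lemma IsDualizableObj.isNoetherian (hA : IsLocallyNoetherianCat A) (hC1 : CondC1 A) {D : A}
    (hD : IsDualizableObj D) : isNoetherianObject D := by
  obtain ⟨E, ⟨_⟩⟩ := hD
  have : IsFinitelyPresentable.{v} (𝟙_ A) := hC1
  obtain ⟨J, _, _, F, ι, hF, ⟨hc⟩⟩ := exists_filtered_isColimit_isNoetherianObject hA D
  -- The coevaluation factors through a noetherian stage tensored with `E`; the triangle identity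
  -- then makes `D` a retract of that stage.
  obtain ⟨s, p, hp⟩ := IsFinitelyPresentable.exists_hom_of_isColimit
    (isColimitOfPreserves (tensorRight E) hc) (η_ D E)
  let i : F.obj s ⟶ D := ι.app s
  have hp' : p ≫ i ▷ E = η_ D E := hp
  let r : D ⟶ F.obj s := (λ_ D).inv ≫ p ▷ D ≫ (α_ _ _ _).hom ≫ _ ◁ ε_ D E ≫ (ρ_ _).hom
  have hr : r ≫ i = 𝟙 D := by
    calc
      _ = (λ_ D).inv ≫ (p ≫ i ▷ E) ▷ D ≫ (α_ _ _ _).hom ≫ _ ◁ ε_ D E ≫ (ρ_ _).hom := by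
        simp only [r, Category.assoc, comp_whiskerRight, associator_naturality_left_assoc,
          ← whisker_exchange_assoc, rightUnitor_naturality]
      _ = _ := by simp [hp']
  have : Mono r := mono_of_mono_fac hr
  exact isNoetherianObject.prop_of_mono r (hF s)

/-- In each variable the condition defines a torsion class, so it suffices to treat dualizable
generators. -/
lemma isNoetherianObject_tensor (hA : IsLocallyNoetherianCat A) (hC1 : CondC1 A) (hC2 : CondC2 A)
    {X Y : A} (hX : isNoetherianObject X) (hY : isNoetherianObject Y) :
    isNoetherianObject (X ⊗ Y) := by
  obtain ⟨ι, G, hG, hsep⟩ := hC2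
  refine (isTorsionClass_isNoetherianObject.inverseImage (tensorRight Y)).prop_of_isSeparating
    hsep ?_ hX
  rintro _ ⟨i⟩
  refine (isTorsionClass_isNoetherianObject.inverseImage (tensorLeft (G i))).prop_of_isSeparating
    hsep ?_ hY
  rintro _ ⟨j⟩
  exact ((hG i).tensor (hG j)).isNoetherian hA hC1

end Dualizable

/-! ### Annihilators and prime objects. -/

section Annihilators

variable {A : Type u} [Category.{v} A] [Abelian A] [MonoidalCategory A]

/-- The ideal given by the image of `j` annihilates `X`. -/
def Annihilates {J : A} (j : J ⟶ 𝟙_ A) (X : A) : Prop := X ◁ j = 0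

instance mono_whiskerRight_unit {X Y : A} (f : X ⟶ Y) [Mono f] : Mono (f ▷ 𝟙_ A) := by
  have : f ▷ 𝟙_ A = (ρ_ X).hom ≫ f ≫ (ρ_ Y).inv := by simp
  rw [this]
  infer_instance

variable {J : A} {j : J ⟶ 𝟙_ A}

/-- The annihilator of `X` is thus an actual subobject of the unit, the kernel of `𝟙_ A ⟶ [X, X]`.
-/
lemma annihilates_iff_comp_id_eq_zero [MonoidalClosed A] {X : A} :
    Annihilates j X ↔ j ≫ MonoidalClosed.id X = 0 := by
  have h : j ≫ MonoidalClosed.id X = MonoidalClosed.curry (X ◁ j ≫ (ρ_ X).hom) :=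
    (MonoidalClosed.curry_natural_left _ _).symm
  have h0 : MonoidalClosed.curry (0 : X ⊗ J ⟶ X) = 0 := by
    rw [MonoidalClosed.curry_eq]
    simp
  rw [h, ← h0, (MonoidalClosed.curry_injective).eq_iff, ← zero_comp (f := (ρ_ X).hom),
    cancel_mono]
  rfl

lemma not_annihilates_id {X : A} (hX : ¬ IsZero X) : ¬ Annihilates (𝟙 (𝟙_ A)) X := by
  intro h
  refine hX ((IsZero.iff_id_eq_zero _).2 ?_)
  rw [← cancel_epi (ρ_ X).hom, comp_zero, Category.comp_id, ← Category.id_comp (ρ_ X).hom,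
    ← whiskerLeft_id, h, zero_comp]

lemma Annihilates.of_mono [MonoidalClosed A] {X Y : A} (f : X ⟶ Y) [Mono f]
    (h : Annihilates j Y) : Annihilates j X := by
  have h' : X ◁ j ≫ f ▷ 𝟙_ A = 0 := by
    rw [whisker_exchange, h, comp_zero]
  rwa [← zero_comp (f := f ▷ 𝟙_ A), cancel_mono] at h'

section

variable [MonoidalClosed A]

lemma Annihilates.tensor_left {X : A} (Y : A) (h : Annihilates j X) : Annihilates j (Y ⊗ X) := by
  unfold Annihilates at *
  rw [tensor_whiskerLeft, h, whiskerLeft_zero']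
  simp

/-- All nonzero subobjects of the nonzero object `N` have the same annihilator. -/
structure IsPrimeObj (N : A) : Prop where
  not_isZero : ¬ IsZero N
  annihilates : ∀ ⦃N' : A⦄ (i : N' ⟶ N), Mono i → ¬ IsZero N' →
    ∀ ⦃J : A⦄ (j : J ⟶ 𝟙_ A), Annihilates j N' → Annihilates j N

/-- A nonzero subobject with maximal annihilator works, since annihilators grow on passing to
subobjects. -/
lemma exists_isPrimeObj (h : isNoetherianObject (𝟙_ A)) {N : A} (hN : ¬ IsZero N) :
    ∃ (N' : A) (i : N' ⟶ N), Mono i ∧ IsPrimeObj N' := by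
  have : WellFoundedGT (Subobject (𝟙_ A)) := h
  obtain ⟨_, ⟨N', i, hi, hN', rfl⟩, hmax⟩ := WellFounded.has_min
    (wellFounded_gt (α := Subobject (𝟙_ A)))
    {t | ∃ (N' : A) (i : N' ⟶ N), Mono i ∧ ¬ IsZero N' ∧
      t = kernelSubobject (MonoidalClosed.id N')} ⟨_, N, 𝟙 N, inferInstance, hN, rfl⟩
  refine ⟨N', i, hi, hN', fun N'' i' _ hN'' J j hj => ?_⟩
  rw [annihilates_iff_comp_id_eq_zero] at hj ⊢
  rw [← kernelSubobject_factors_iff] at hj ⊢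
  refine Subobject.factors_of_le _ ?_ hj
  by_contra h'
  refine hmax _ ⟨N'', i' ≫ i, inferInstance, hN'', rfl⟩ (lt_of_le_not_ge ?_ h')
  refine le_kernelSubobject _ _ ?_
  rw [← annihilates_iff_comp_id_eq_zero]
  refine Annihilates.of_mono i' ?_
  rw [annihilates_iff_comp_id_eq_zero, kernelSubobject_arrow_comp]

/-- The noetherian objects which are annihilated by some ideal not annihilating `N`. -/
def annihilatedOutside (N : A) : ObjectProperty A :=
  fun X => isNoetherianObject X ∧ ∃ (J : A) (j : J ⟶ 𝟙_ A), Annihilates j X ∧ ¬ Annihilates j N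

lemma annihilatedOutside.exists_mono {N X : A} (h : annihilatedOutside N X) :
    ∃ (J : A) (j : J ⟶ 𝟙_ A), Mono j ∧ Annihilates j X ∧ ¬ Annihilates j N := by
  obtain ⟨-, J, j, hj, hj'⟩ := h
  refine ⟨_, kernel.ι (MonoidalClosed.id X), inferInstance, ?_, fun h => hj' ?_⟩
  · rw [annihilates_iff_comp_id_eq_zero, kernel.condition]
  · rw [annihilates_iff_comp_id_eq_zero] at hj h ⊢
    rw [← kernel.lift_ι _ _ hj, Category.assoc, h, comp_zero]

omit [Abelian A] [MonoidalClosed A] in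
lemma whiskerLeft_mul {K : A} (k : K ⟶ 𝟙_ A) (j : J ⟶ 𝟙_ A) (X : A) :
    X ◁ (k ▷ J ≫ (λ_ J).hom ≫ j) = (α_ X K J).inv ≫ (X ◁ k ≫ (ρ_ X).hom) ▷ J ≫ X ◁ j := by
  simp

variable [SymmetricCategory A]

lemma annihilates_image {X Y : A} {f : X ⟶ Y} (h : X ◁ j ≫ f ▷ 𝟙_ A = 0) :
    Annihilates j (image f) := by
  have e : X ◁ j ≫ f ▷ 𝟙_ A =
      factorThruImage f ▷ J ≫ (image f ◁ j) ≫ image.ι f ▷ 𝟙_ A := by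
    rw [← whisker_exchange_assoc, ← comp_whiskerRight, image.fac]
  rw [h, ← comp_zero (f := factorThruImage f ▷ J), cancel_epi,
    ← zero_comp (f := image.ι f ▷ 𝟙_ A), cancel_mono] at e
  exact e.symm

lemma Annihilates.of_epi {X Y : A} (f : X ⟶ Y) [Epi f]
    (h : Annihilates j X) : Annihilates j Y := by
  have h' : f ▷ J ≫ Y ◁ j = 0 := by
    rw [← whisker_exchange, h, zero_comp]
  rwa [← comp_zero (f := f ▷ J), cancel_epi] at h'

lemma Annihilates.tensor_right {X : A} (Y : A) (h : Annihilates j X) : Annihilates j (X ⊗ Y) :=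
  (h.tensor_left Y).of_epi (β_ Y X).hom

namespace IsPrimeObj

variable {N : A}

lemma annihilates_of_ne_zero (hN : IsPrimeObj N) {Y : A} {f : Y ⟶ N} (hf : f ≠ 0)
    (h : Y ◁ j ≫ f ▷ 𝟙_ A = 0) : Annihilates j N := by
  refine hN.annihilates (image.ι f) inferInstance (fun h0 => hf ?_) j (annihilates_image h)
  rw [← image.fac f, h0.eq_of_tgt (factorThruImage f) 0, zero_comp]

end IsPrimeObj

/-- For extensions, the product of the two ideals kills the middle term. It does not kill `N`:
otherwise `J` would kill the nonzero subobject `K · N`, hence `N` by primeness. -/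
lemma IsPrimeObj.isSerreClass_annihilatedOutside {N : A} (hN : IsPrimeObj N) :
    (annihilatedOutside N).IsSerreClass where
  exists_zero := by
    obtain ⟨Z, hZ, hZ'⟩ := (isNoetherianObject (C := A)).exists_prop_of_containsZero
    exact ⟨Z, hZ, hZ', 𝟙_ A, 𝟙 _, ((tensorRight (𝟙_ A)).map_isZero hZ).eq_of_src _ _,
      not_annihilates_id hN.not_isZero⟩
  prop_of_mono f _ := fun ⟨hX, J, j, hj, hj'⟩ =>
    ⟨isNoetherianObject.prop_of_mono f hX, J, j, hj.of_mono f, hj'⟩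
  prop_of_epi f _ := fun ⟨hX, J, j, hj, hj'⟩ =>
    ⟨isNoetherianObject.prop_of_epi f hX, J, j, hj.of_epi f, hj'⟩
  prop_X₂_of_shortExact {S} hS := fun ⟨hX, J, j, hj, hj'⟩ ⟨hX', K, k, hk, hk'⟩ => by
    refine ⟨isNoetherianObject.prop_X₂_of_shortExact hS hX hX', _,
      k ▷ J ≫ (λ_ J).hom ≫ j, ?_, fun h => ?_⟩
    · have := hS.mono_f
      let u : S.X₂ ⊗ K ⟶ S.X₁ := hS.exact.lift (S.X₂ ◁ k ≫ (ρ_ _).hom) (by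
        rw [Category.assoc, ← rightUnitor_naturality, whisker_exchange_assoc, hk, zero_comp,
          comp_zero])
      have hu : u ≫ S.f = S.X₂ ◁ k ≫ (ρ_ _).hom := hS.exact.lift_f _ _
      unfold Annihilates
      rw [whiskerLeft_mul, ← hu, comp_whiskerRight, Category.assoc, ← whisker_exchange, hj]
      simp
    · unfold Annihilates at h
      rw [whiskerLeft_mul, ← comp_zero (f := (α_ N K J).inv), cancel_epi, ← whisker_exchange] at h
      refine hj' (hN.annihilates_of_ne_zero (f := N ◁ k ≫ (ρ_ N).hom) (fun h0 => hk' ?_) ?_)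
      · rwa [← zero_comp (f := (ρ_ N).hom), cancel_mono] at h0
      · exact h

lemma annihilatedOutside.tensor {N X Y : A} (h : annihilatedOutside N X)
    (hXY : isNoetherianObject (X ⊗ Y)) : annihilatedOutside N (X ⊗ Y) := by
  obtain ⟨-, J, j, hj, hj'⟩ := h
  exact ⟨hXY, J, j, hj.tensor_right Y, hj'⟩

end

end Annihilators

/-! ### Group actions and subobjects of translates. -/

namespace WeakAction

variable {G : Type w} [Group G] {A : Type u} [Category.{v} A] (ρ : WeakAction G A)

lemma nonempty_iso_mul (g h : G) (X : A) :
    Nonempty ((ρ.act (g * h)).functor.obj X ≅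
      (ρ.act g).functor.obj ((ρ.act h).functor.obj X)) :=
  (ρ.act_mul g h).map fun e => e.app X

lemma nonempty_iso_one (X : A) : Nonempty ((ρ.act 1).functor.obj X ≅ X) :=
  ρ.act_one.map fun e => e.app X

lemma nonempty_iso_inv_left (g : G) (X : A) :
    Nonempty ((ρ.act g⁻¹).functor.obj ((ρ.act g).functor.obj X) ≅ X) := by
  obtain ⟨e⟩ := ρ.nonempty_iso_mul g⁻¹ g X
  obtain ⟨e'⟩ := ρ.nonempty_iso_one X
  rw [inv_mul_cancel] at e
  exact ⟨e.symm ≪≫ e'⟩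

variable {ρ}

lemma IsClosed.of_act {P : ObjectProperty A} [P.IsClosedUnderIsomorphisms] (hP : ρ.IsClosed P)
    {g : G} {X : A} (h : P ((ρ.act g).functor.obj X)) : P X :=
  P.prop_of_iso (ρ.nonempty_iso_inv_left g X).some (hP g⁻¹ _ h)

lemma IsClosed.filtered [Abelian A] {P : ObjectProperty A} (hP : ρ.IsClosed P) :
    ρ.IsClosed (Filtered P) := fun g _ hX =>
  have := (ρ.act g).functor.additive_of_preserves_binary_products
  hX.map (ρ.act g).functor fun _ => hP g _

lemma IsClosed.quotientsOf [Abelian A] {P : ObjectProperty A} (hP : ρ.IsClosed P) :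
    ρ.IsClosed (quotientsOf P) := by
  rintro g Y ⟨X, p, hX, hp⟩
  exact ⟨_, (ρ.act g).functor.map p, hP g X hX, inferInstance⟩

end WeakAction

section OrbitSubobjects

variable {G : Type w} [Group G] {A : Type u} [Category.{v} A] (ρ : WeakAction G A)

/-- The objects which lie in `S` or embed into a translate of `Q`. -/
def orbitSubobjects (S : ObjectProperty A) (Q : A) : ObjectProperty A :=
  fun Z => S Z ∨ ∃ (g : G) (i : Z ⟶ (ρ.act g).functor.obj Q), Mono i

variable {ρ} [Abelian A] {S : ObjectProperty A} {Q : A} [S.IsSerreClass]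

instance : (orbitSubobjects ρ S Q).IsClosedUnderSubobjects where
  prop_of_mono f _ h := by
    obtain h | ⟨g, i, hi⟩ := h
    · exact .inl (S.prop_of_mono f h)
    · exact .inr ⟨g, f ≫ i, inferInstance⟩

omit [S.IsSerreClass] in
lemma WeakAction.IsClosed.orbitSubobjects (hS : ρ.IsClosed S) :
    ρ.IsClosed (orbitSubobjects ρ S Q) := by
  rintro g Z (h | ⟨g', i, hi⟩)
  · exact .inl (hS g Z h)
  · exact .inr ⟨g * g', (ρ.act g).functor.map i ≫ (ρ.nonempty_iso_mul g g' Q).some.inv,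
      inferInstance⟩

/-- If all proper quotients of `Q` lie in `S`, then so do those of its translates. -/
lemma prop_of_epi_act (hS : ρ.IsClosed S)
    (hQ : ∀ ⦃Y : A⦄ (p : Q ⟶ Y), Epi p → ¬ S Y → Mono p) {g : G} {Y : A}
    (p : (ρ.act g).functor.obj Q ⟶ Y) [Epi p] (hp : ¬ Mono p) : S Y := by
  by_contra hY
  let e := (ρ.nonempty_iso_inv_left g Q).some
  have h : Mono (e.inv ≫ (ρ.act g⁻¹).functor.map p) := hQ _ inferInstance fun h => hY (hS.of_act h)
  have h' : Mono ((ρ.act g⁻¹).functor.map p) := by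
    have := mono_comp e.hom (e.inv ≫ (ρ.act g⁻¹).functor.map p)
    simpa using this
  exact hp ((ρ.act g⁻¹).functor.mono_of_mono_map h')

/-- A proper quotient of a subobject of a translate of `Q` embeds, by pushout, into a proper
quotient of that translate, which lies in `S`. -/
lemma isClosedUnderQuotients_orbitSubobjects (hS : ρ.IsClosed S)
    (hQ : ∀ ⦃Y : A⦄ (p : Q ⟶ Y), Epi p → ¬ S Y → Mono p) :
    (orbitSubobjects ρ S Q).IsClosedUnderQuotients where
  prop_of_epi {Z W} q _ h := by
    obtain h | ⟨g, i, hi⟩ := h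
    · exact .inl (S.prop_of_epi q h)
    · by_cases hq : Mono q
      · have := isIso_of_mono_of_epi q
        exact .inr ⟨g, inv q ≫ i, inferInstance⟩
      · refine .inl (S.prop_of_mono (pushout.inl q i) (prop_of_epi_act hS hQ (pushout.inr q i) ?_))
        intro h
        have := mono_comp i (pushout.inr q i)
        rw [← pushout.condition] at this
        exact hq (mono_of_mono q (pushout.inl q i))

end OrbitSubobjects

/-! ### Tensor ideal torsion classes are Serre. -/

section TensorTorsion

variable {A : Type u} [Category.{v} A] [Abelian A]
  [MonoidalCategory A] [SymmetricCategory A] [MonoidalClosed A]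

/-- The ideal of elements killed by `𝟙_ A ⟶ D ⊗ E ⟶ Q ⊗ E` annihilates the image of `D ⟶ Q`. -/
lemma annihilates_image_of_comp_coevaluation {D E Q J : A} [ExactPairing D E] (f : D ⟶ Q)
    (j : J ⟶ 𝟙_ A) (h : j ≫ η_ D E ≫ f ▷ E = 0) : Annihilates j (image f) := by
  refine annihilates_image ?_
  have h₁ : (η_ D E ≫ f ▷ E) ▷ D ≫ (α_ Q E D).hom ≫ Q ◁ ε_ D E = (λ_ D).hom ≫ f ≫ (ρ_ Q).inv := by
    rw [comp_whiskerRight, Category.assoc, associator_naturality_left_assoc, ← whisker_exchange,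
      ExactPairing.evaluation_coevaluation_assoc]
    simp
  have h₂ : j ▷ D ≫ (λ_ D).hom ≫ f ≫ (ρ_ Q).inv = 0 := by
    rw [← h₁, ← comp_whiskerRight_assoc, h, zero_whiskerRight', zero_comp]
  have h₃ : j ▷ D ≫ (λ_ D).hom ≫ f = 0 := by
    simpa using h₂ =≫ (ρ_ Q).hom
  rw [← cancel_epi (β_ J D).hom, ← BraidedCategory.braiding_naturality_left_assoc,
    ← cancel_mono (ρ_ Q).hom]
  simpa using h₃

variable [IsGrothendieckAbelian.{v} A] {G : Type w} [Group G] {ρ : WeakAction G A}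

/-- A tensor ideal torsion class does not contain an object having a prime subobject which
receives no nonzero map from the torsion class. -/
lemma IsPrimeObj.false_of_torsion (hA : IsLocallyNoetherianCat A) (hC1 : CondC1 A)
    (hC2 : CondC2 A) (h : tensorTorsNoeth A = ρ.torsNoeth) {T : ObjectProperty A}
    (hT : T ∈ tensorTorsNoeth A) {N M : A} (hN : IsPrimeObj N) (i : N ⟶ M) [Mono i] (hM : T M)
    (hperp : ∀ ⦃Z : A⦄ (f : Z ⟶ N), T Z → f = 0) : False := by
  have hTG : T ∈ ρ.torsNoeth := h ▸ hT
  obtain ⟨hTn, hTt, hTI⟩ := hT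
  have hTG := hTG.2.2
  have := hTt.quotients
  have hNn : isNoetherianObject N := isNoetherianObject.prop_of_mono i (hTn _ hM)
  let S := annihilatedOutside N
  have hS : S.IsSerreClass := hN.isSerreClass_annihilatedOutside
  have hSn : S ≤ isNoetherianObject := fun _ h => h.1
  have hSt : IsTorsionClass S := ⟨inferInstance, inferInstance, inferInstance⟩
  have hSG : ρ.IsClosed S := by
    have : S ∈ tensorTorsNoeth A := ⟨hSn, hSt, fun X Y hX hY => hX.tensor
      (isNoetherianObject_tensor hA hC1 hC2 hX.1 hY)⟩
    exact (h ▸ this : S ∈ ρ.torsNoeth).2.2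
  have hSM : ¬ S M := fun ⟨_, J, j, hj, hj'⟩ => hj' (hj.of_mono i)
  obtain ⟨Q, q, hq, hSQ, hmin⟩ := exists_minimal_quotient (fun X => ¬ S X) (hTn _ hM) hSM
  have hTQ : T Q := T.prop_of_epi q hM
  have hQn := hTn _ hTQ
  have := isClosedUnderQuotients_orbitSubobjects hSG hmin
  have hle : orbitSubobjects ρ S Q ≤ isNoetherianObject := by
    rintro Z (hZ | ⟨g, i, _⟩)
    · exact hSn _ hZ
    · exact isNoetherianObject.prop_of_mono i (hTn _ (hTG g Q hTQ))
  let C := Filtered (orbitSubobjects ρ S Q)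
  have hCI : C ∈ tensorTorsNoeth A := h ▸ ⟨Filtered.le_of_le hle,
    ⟨inferInstance, inferInstance, inferInstance⟩, hSG.orbitSubobjects.filtered⟩
  have hCQ : C Q := .of_prop (.inr ⟨1, (ρ.nonempty_iso_one Q).some.inv, inferInstance⟩)
  obtain ⟨T₁, t, _, hT₁, ht⟩ := hSt.exists_radical hQn
  have hπ : cokernel.π t ≠ 0 := fun h0 => hSQ <| by
    have : Epi t := Preadditive.epi_of_cokernel_zero h0
    exact S.prop_of_epi t hT₁
  -- Some generator maps to `Q` outside the `S`-radical, so its image is not in `S`.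
  obtain ⟨D, ⟨E, ⟨_⟩⟩, f, hf⟩ : ∃ (D : A), IsDualizableObj D ∧ ∃ f : D ⟶ Q,
      f ≫ cokernel.π t ≠ 0 := by
    obtain ⟨ι, F, hF, hsep⟩ := hC2
    by_contra! h'
    refine hπ (hsep _ _ ?_)
    rintro _ ⟨i⟩ f
    rw [h' _ (hF i) f, comp_zero]
  have hSf : ¬ S (image f) := fun h' => hf <| by
    rw [← image.fac f, Category.assoc, ht (image.ι f ≫ cokernel.π t) h', comp_zero]
  let φ : 𝟙_ A ⟶ Q ⊗ E := η_ D E ≫ f ▷ E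
  -- The kernel of `φ` kills `image f`, which is outside `S`, so it must kill `N`. Hence `𝟙_ A ⟶ [N,
  -- N]` factors through `image φ`, an object of `C`.
  have hφN : kernel.ι φ ≫ MonoidalClosed.id N = 0 := by
    rw [← annihilates_iff_comp_id_eq_zero]
    by_contra h'
    exact hSf ⟨isNoetherianObject.prop_of_mono (image.ι f) hQn, _, kernel.ι φ,
      annihilates_image_of_comp_coevaluation f _ (kernel.condition φ), h'⟩
  have hCφ : C (image φ) := C.prop_of_mono (image.ι φ) (hCI.2.2 _ _ hCQ
    (IsDualizableObj.symm (D := D) (E := E) |>.isNoetherian hA hC1))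
  let r : image φ ⟶ (ihom N).obj N := (shortExact_image φ).exact.desc (MonoidalClosed.id N) hφN
  have hr : factorThruImage φ ≫ r = MonoidalClosed.id N := (shortExact_image φ).exact.g_desc _ _
  have hr0 : ¬ IsZero (image r) := fun h0 => not_annihilates_id hN.not_isZero <| by
    rw [annihilates_iff_comp_id_eq_zero, ← hr, ← image.fac r,
      h0.eq_of_tgt (factorThruImage r) 0]
    simp
  obtain ⟨Z, z, hz, hZ0, Z', hZ', ⟨e⟩⟩ := Filtered.exists_mono_ne_zero
    (C.prop_of_epi (factorThruImage r) hCφ) hr0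
  have hZ := (orbitSubobjects ρ S Q).prop_of_iso e.symm hZ'
  let μ : N ⊗ Z ⟶ N := MonoidalClosed.uncurry (z ≫ image.ι r)
  have hμ : μ ≠ 0 := fun h0 => hZ0 <| by
    have : z ≫ image.ι r = 0 := by
      apply MonoidalClosed.uncurry_injective
      rw [MonoidalClosed.uncurry_eq 0, whiskerLeft_zero', zero_comp]
      exact h0
    exact IsZero.of_mono_eq_zero _ this
  obtain ⟨_, J, j, hj, hj'⟩ | ⟨g, a, ha⟩ := hZ
  · refine hj' (hN.annihilates_of_ne_zero hμ ?_)
    rw [hj.tensor_left N, zero_comp]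
  -- As `Z` is nonzero, `gQ / Z` is a proper quotient, killed by an ideal `K` not killing `N`; so
  -- `K` multiplies `gQ` into `Z`.
  · have hcok : S (cokernel a) := prop_of_epi_act hSG hmin (cokernel.π a) fun h' => hZ0 <|
      IsZero.of_mono_eq_zero a (by rw [← cancel_mono (cokernel.π a), cokernel.condition, zero_comp])
    obtain ⟨K, k, hk, hkC, hkN⟩ := hcok.exists_mono
    let gQ := (ρ.act g).functor.obj Q
    let b : gQ ⊗ K ⟶ gQ := gQ ◁ k ≫ (ρ_ gQ).hom
    have hb : b ≫ cokernel.π a = 0 := by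
      rw [Category.assoc, ← rightUnitor_naturality, whisker_exchange_assoc, hkC, zero_comp,
        comp_zero]
    let l : gQ ⊗ K ⟶ Z := Abelian.monoLift a b hb
    have hl : l ≫ a = b := Abelian.monoLift_comp _ _ _
    have hal : a ▷ K ≫ l = Z ◁ k ≫ (ρ_ Z).hom := by
      rw [← cancel_mono a, Category.assoc, hl, ← whisker_exchange_assoc]
      simp
    have hKn : isNoetherianObject K :=
      isNoetherianObject.prop_of_mono k (isDualizableObj_unit.isNoetherian hA hC1)
    have hTl : T (N ⊗ (gQ ⊗ K)) :=
      T.prop_of_iso (β_ _ _) (hTI _ _ (hTI _ _ (hTG g Q hTQ) hKn) hNn)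
    -- The source lies in `T`, so the map to `N` vanishes. Restricted along `a`, this says that `K`
    -- kills the image of `μ`.
    have h0 : N ◁ l ≫ μ = 0 := hperp _ hTl
    refine hkN (hN.annihilates_of_ne_zero hμ ?_)
    have h1 := N ◁ (a ▷ K) ≫= h0
    rw [← whiskerLeft_comp_assoc, hal, comp_zero] at h1
    have h2 := (α_ N Z K).hom ≫= h1
    rw [← cancel_mono (ρ_ N).hom]
    simpa using h2

/-- A tensor ideal torsion class is a Serre subcategory. -/
lemma isSerreClass_of_mem_tensorTorsNoeth (hA : IsLocallyNoetherianCat A) (hC1 : CondC1 A)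
    (hC2 : CondC2 A) (h : tensorTorsNoeth A = ρ.torsNoeth) {T : ObjectProperty A}
    (hT : T ∈ tensorTorsNoeth A) : T.IsSerreClass := by
  have := hT.2.1.containsZero
  have := hT.2.1.quotients
  have := hT.2.1.extensions
  suffices T.IsClosedUnderSubobjects from ⟨⟩
  refine ⟨fun {X Y} f _ hY => ?_⟩
  by_contra hX
  -- `X / R` receives no nonzero map from `T` and embeds into `Y / R`, which is in `T`.
  obtain ⟨R, t, _, hR, ht⟩ := hT.2.1.exists_radical
    (isNoetherianObject.prop_of_mono f (hT.1 _ hY))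
  have h0 : ¬ IsZero (cokernel t) := fun h0 => hX <| by
    have : Epi t := Preadditive.epi_of_cokernel_zero (h0.eq_of_tgt _ _)
    exact T.prop_of_epi t hR
  obtain ⟨N, i, _, hN⟩ := exists_isPrimeObj (isDualizableObj_unit.isNoetherian hA hC1) h0
  let a : cokernel t ⟶ cokernel (t ≫ f) := cokernel.map t (t ≫ f) (𝟙 _) f (by simp)
  have : Mono a := by
    refine Preadditive.mono_of_cancel_zero _ fun {Z} x hx => ?_
    obtain ⟨Z', π, _, y, hy⟩ := surjective_up_to_refinements_of_epi (cokernel.π t) x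
    have hy' : (y ≫ f) ≫ cokernel.π (t ≫ f) = 0 := by
      simpa [a, hx] using (hy =≫ a).symm
    have hy'' : Abelian.monoLift (t ≫ f) (y ≫ f) hy' ≫ t = y := by
      rw [← cancel_mono f, Category.assoc, Abelian.monoLift_comp]
    rw [← cancel_epi π, hy, ← hy'', Category.assoc, cokernel.condition, comp_zero, comp_zero]
  refine hN.false_of_torsion hA hC1 hC2 h hT (i ≫ a) (T.prop_of_epi (cokernel.π (t ≫ f)) hY)
    fun Z g hZ => ?_
  rw [← cancel_mono i, ht (g ≫ i) hZ, zero_comp]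

theorem tfae_of_tensorTorsNoeth_eq (hA : IsLocallyNoetherianCat A) (hC1 : CondC1 A)
    (hC2 : CondC2 A) (h : tensorTorsNoeth A = ρ.torsNoeth) {X : ObjectProperty A}
    [X.IsClosedUnderIsomorphisms] (hX : X ≤ isNoetherianObject) (hXG : ρ.IsClosed X) :
    [X.IsSerreClass, IsTorsionClass X, IsWide X, IsICEClosed X, IsCEClosed X].TFAE ∧
      [IsTorsionFreeClass X, IsIKEClosed X, IsIEClosed X].TFAE := by
  have key (T : ObjectProperty A) (hT : T ≤ isNoetherianObject) (hTG : ρ.IsClosed T)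
      (hTt : IsTorsionClass T) : T.IsSerreClass :=
    isSerreClass_of_mem_tensorTorsNoeth hA hC1 hC2 h (h ▸ ⟨hT, hTt, hTG⟩)
  have hn : Filtered (quotientsOf X) ≤ isNoetherianObject := Filtered.le_of_le <| by
    rintro Y ⟨Z, p, hZ, _⟩
    exact isNoetherianObject.prop_of_epi p (hX _ hZ)
  have hG := hXG.quotientsOf.filtered
  refine ⟨tfae_isSerreClass ?_, tfae_isTorsionFreeClass
    (key _ hn hG isTorsionClass_filtered_quotientsOf)⟩
  rintro _ (rfl | rfl)
  · exact key _ hX hXG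
  · exact key _ hn hG

end TensorTorsion

/-! ### Perfect pairings and duality. -/

section PerfectPairings

variable {A : Type u} [Category.{v} A] [MonoidalCategory A]

/-- The morphism `T ⊗ E ⟶ W` attached to `T ⟶ W ⊗ V` by a pairing `V ⊗ E ⟶ 𝟙_ A`. -/
def transposeAlong {V E : A} (δ : V ⊗ E ⟶ 𝟙_ A) {T W : A} (x : T ⟶ W ⊗ V) : T ⊗ E ⟶ W :=
  x ▷ E ≫ (α_ W V E).hom ≫ W ◁ δ ≫ (ρ_ W).hom

lemma transposeAlong_comp {V E : A} (δ : V ⊗ E ⟶ 𝟙_ A) {T' T W : A} (y : T' ⟶ T)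
    (x : T ⟶ W ⊗ V) : transposeAlong δ (y ≫ x) = y ▷ E ≫ transposeAlong δ x := by
  simp [transposeAlong]

lemma transposeAlong_comp_whiskerLeft {V V' E : A} (δ : V ⊗ E ⟶ 𝟙_ A) (h : V' ⟶ V) {T W : A}
    (x : T ⟶ W ⊗ V') : transposeAlong δ (x ≫ W ◁ h) = transposeAlong (h ▷ E ≫ δ) x := by
  simp [transposeAlong]

lemma whiskerLeft_transposeAlong {V E E' : A} (δ : V ⊗ E ⟶ 𝟙_ A) (f : E' ⟶ E) {T W : A}
    (x : T ⟶ W ⊗ V) : T ◁ f ≫ transposeAlong δ x = transposeAlong (V ◁ f ≫ δ) x := by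
  simp [transposeAlong, whisker_exchange_assoc]

/-- A pairing is perfect if it exhibits `- ⊗ V` as a right adjoint of `- ⊗ E`. -/
def IsPerfectPairing {V E : A} (δ : V ⊗ E ⟶ 𝟙_ A) : Prop :=
  ∀ T W : A, Function.Bijective (transposeAlong δ (T := T) (W := W))

lemma isPerfectPairing_evaluation (E V : A) [ExactPairing E V] : IsPerfectPairing (ε_ E V) :=
  fun T W => (tensorRightHomEquiv T E V W).symm.bijective

/-- Surjectivity supplies a coevaluation satisfying one triangle identity; injectivity yields the
other. -/
lemma IsPerfectPairing.isDualizableObj {V E : A} {δ : V ⊗ E ⟶ 𝟙_ A} (h : IsPerfectPairing δ) :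
    IsDualizableObj E := by
  obtain ⟨η, hη⟩ := (h (𝟙_ A) E).2 (λ_ E).hom
  have hη' : η ▷ E ≫ (α_ E V E).hom ≫ E ◁ δ = (λ_ E).hom ≫ (ρ_ E).inv := by
    rw [← hη]
    simp [transposeAlong]
  refine ⟨V, ⟨ExactPairing.mk (coevaluation' := η) (evaluation' := δ) ?_ hη'⟩⟩
  apply (h _ _).1
  have e : transposeAlong δ (V ◁ η ≫ (α_ V E V).inv ≫ δ ▷ V) =
      (α_ V (𝟙_ A) E).hom ≫ V ◁ (η ▷ E ≫ (α_ E V E).hom ≫ E ◁ δ) ≫ (α_ V E (𝟙_ A)).inv ≫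
        (ρ_ _).hom ≫ δ := by
    simp only [transposeAlong, comp_whiskerRight, Category.assoc, associator_naturality_left_assoc]
    rw [← whisker_exchange_assoc]
    simp
  rw [e, hη']
  simp [transposeAlong, unitors_inv_equal]

end PerfectPairings

/-! ### Invertible-filtered objects are dualizable. -/

section Extensions

variable {A : Type u} [Category.{v} A] [MonoidalCategory A] [SymmetricCategory A]

lemma IsInvertibleObj.isEquivalence_tensorRight {L : A} (hL : IsInvertibleObj L) :
    (tensorRight L).IsEquivalence := by
  obtain ⟨M, ⟨e⟩⟩ := hL
  let e' : M ⊗ L ≅ 𝟙_ A := β_ _ _ ≪≫ e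
  exact (CategoryTheory.Equivalence.mk (tensorRight L) (tensorRight M)
    ((NatIso.ofComponents (fun X => ρ_ X) : tensorRight (𝟙_ A) ≅ 𝟭 A).symm ≪≫
      (tensoringRight A).mapIso e.symm ≪≫ tensorRightTensor _ _)
    ((tensorRightTensor _ _).symm ≪≫ (tensoringRight A).mapIso e' ≪≫
      (NatIso.ofComponents (fun X => ρ_ X) : tensorRight (𝟙_ A) ≅ 𝟭 A))).isEquivalence_functor

lemma IsInvertibleObj.isDualizableObj {L : A} (hL : IsInvertibleObj L) : IsDualizableObj L := by
  have := hL.isEquivalence_tensorRight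
  obtain ⟨M, ⟨e⟩⟩ := hL
  refine IsPerfectPairing.isDualizableObj (V := M) (δ := (β_ M L).hom ≫ e.hom) fun T W => ?_
  let i : (W ⊗ M) ⊗ L ≅ W := α_ W M L ≪≫ whiskerLeftIso W (β_ M L ≪≫ e) ≪≫ ρ_ W
  have h : Function.Bijective fun x : T ⟶ W ⊗ M => (tensorRight L).map x ≫ i.hom :=
    (i.homToEquiv.bijective.comp
      ((Functor.FullyFaithful.ofFullyFaithful (tensorRight L)).map_bijective T (W ⊗ M)))
  have e : transposeAlong ((β_ M L).hom ≫ e.hom) =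
      fun x : T ⟶ W ⊗ M => (tensorRight L).map x ≫ i.hom := by
    ext x
    simp [transposeAlong, i]
  rwa [e]

omit [SymmetricCategory A] in
lemma IsDualizableObj.of_iso {D D' : A} (e : D ≅ D') (hD : IsDualizableObj D) :
    IsDualizableObj D' := by
  obtain ⟨E, ⟨_⟩⟩ := hD
  exact ⟨E, ⟨exactPairingCongrLeft e.symm⟩⟩

variable [Abelian A] [MonoidalClosed A]

lemma monoidalPreadditive_of_closed : MonoidalPreadditive A where
  whiskerLeft_zero := whiskerLeft_zero' _
  zero_whiskerRight := zero_whiskerRight' _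
  whiskerLeft_add {X} _ _ f g := by
    have := preservesBinaryBiproducts_of_preservesBinaryCoproducts (tensorLeft X)
    have := (tensorLeft X).additive_of_preservesBinaryBiproducts
    exact (tensorLeft X).map_add
  add_whiskerRight {X} _ _ f g := by
    have := preservesBinaryBiproducts_of_preservesBinaryCoproducts (tensorRight X)
    have := (tensorRight X).additive_of_preservesBinaryBiproducts
    exact (tensorRight X).map_add

omit [SymmetricCategory A] in
lemma exact_whiskerLeft {S : ShortComplex A} (hS : S.Exact) [Epi S.g] (X : A) :
    (S.map (tensorLeft X)).Exact :=
  hS.map_of_epi_of_preservesCokernel (tensorLeft X) inferInstance inferInstance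

omit [SymmetricCategory A] in
lemma exists_whiskerLeft_comp_eq {S : ShortComplex A} (hS : S.ShortExact) (X : A) {Y : A}
    (k : X ⊗ S.X₂ ⟶ Y) (hk : X ◁ S.f ≫ k = 0) : ∃ l : X ⊗ S.X₃ ⟶ Y, X ◁ S.g ≫ l = k := by
  have := hS.epi_g
  have : Epi (S.map (tensorLeft X)).g := epi_whiskerLeft' X S.g
  exact ⟨(exact_whiskerLeft hS.exact X).desc k hk, (exact_whiskerLeft hS.exact X).g_desc _ _⟩

/-- An extension of the unit object by a dualizable object is dualizable. -/
lemma isDualizableObj_of_shortExact_unit {E₁ E : A} (f : E₁ ⟶ E) (q : E ⟶ 𝟙_ A) (w : f ≫ q = 0)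
    (hS : (ShortComplex.mk f q w).ShortExact) (h₁ : IsDualizableObj E₁) : IsDualizableObj E := by
  have := monoidalPreadditive_of_closed (A := A)
  obtain ⟨T, ⟨_⟩⟩ := h₁
  have : Mono f := hS.mono_f
  have : Epi q := hS.epi_g
  have : Mono (T ◁ f) := by
    have := BraidedCategory.exactPairing_swap E₁ T
    have := (tensorLeftAdjunction T E₁).isRightAdjoint
    exact inferInstanceAs (Mono ((tensorLeft T).map f))
  -- The candidate dual of `E`: an extension of the dual `T` of `E₁` by the unit.
  let V := pushout (T ◁ f) (ε_ E₁ T)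
  let inl : T ⊗ E ⟶ V := pushout.inl _ _
  let inr : 𝟙_ A ⟶ V := pushout.inr _ _
  have hV : T ◁ f ≫ inl = ε_ E₁ T ≫ inr := pushout.condition
  have : Mono inr := inferInstanceAs (Mono (pushout.inr (T ◁ f) (ε_ E₁ T)))
  let p : V ⟶ T := pushout.desc (T ◁ q ≫ (ρ_ T).hom) 0 (by
    rw [← whiskerLeft_comp_assoc, w, comp_zero]
    simp)
  have hinl : inl ≫ p = T ◁ q ≫ (ρ_ T).hom := pushout.inl_desc _ _ _
  have hinr : inr ≫ p = 0 := pushout.inr_desc _ _ _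
  have hp : Epi p := epi_of_epi_fac hinl
  have hVex : (ShortComplex.mk inr p hinr).Exact := by
    have hdesc {W : A} (k : V ⟶ W) (hk : inr ≫ k = 0) : ∃ l : T ⟶ W, p ≫ l = k := by
      obtain ⟨l, hl⟩ := exists_whiskerLeft_comp_eq hS T (inl ≫ k) (by
        change T ◁ f ≫ inl ≫ k = 0
        rw [← Category.assoc, hV, Category.assoc, hk, comp_zero])
      refine ⟨(ρ_ T).inv ≫ l, pushout.hom_ext ?_ ?_⟩
      · change inl ≫ p ≫ _ = inl ≫ k
        rw [← Category.assoc, hinl, Category.assoc, Iso.hom_inv_id_assoc]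
        exact hl
      · change inr ≫ p ≫ _ = inr ≫ k
        rw [← Category.assoc, hinr, hk, zero_comp]
    exact ShortComplex.exact_of_g_is_cokernel _ (CokernelCofork.IsColimit.ofπ p hinr
      (fun k hk => (hdesc k hk).choose) (fun k hk => (hdesc k hk).choose_spec)
      (fun k hk m hm => by rw [← cancel_epi p, hm, (hdesc k hk).choose_spec]))
  let a : V ⊗ E ⟶ V := V ◁ q ≫ (ρ_ V).hom
  let b : V ⊗ E ⟶ V := p ▷ E ≫ inl
  have hab : (b - a) ≫ p = 0 := by
    rw [Preadditive.sub_comp, Category.assoc, Category.assoc, hinl, ← rightUnitor_naturality,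
      whisker_exchange_assoc, sub_self]
  -- Both maps to `V` agree after `p`, so their difference lands in the unit. On `E₁` the pairing is
  -- the evaluation through `p`; on the unit in `V` it is `-q`.
  let δ : V ⊗ E ⟶ 𝟙_ A := hVex.lift (b - a) hab
  have hδ : δ ≫ inr = b - a := hVex.lift_f _ _
  have hδf : V ◁ f ≫ δ = p ▷ E₁ ≫ ε_ E₁ T := by
    rw [← cancel_mono inr, Category.assoc, hδ, Preadditive.comp_sub, Category.assoc, ← hV,
      ← whiskerLeft_comp_assoc, w, whisker_exchange_assoc]
    simp
  have hδr : inr ▷ E ≫ δ = -((λ_ E).hom ≫ q) := by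
    rw [← cancel_mono inr, Category.assoc, hδ, Preadditive.comp_sub,
      ← comp_whiskerRight_assoc, hinr, ← whisker_exchange_assoc]
    simp [unitors_inv_equal]
  have htr {T' W : A} (y : T' ⟶ W ⊗ 𝟙_ A) : transposeAlong δ (y ≫ W ◁ inr) =
      -(T' ◁ q ≫ (ρ_ T').hom ≫ y ≫ (ρ_ W).hom) := by
    rw [transposeAlong_comp_whiskerLeft, hδr]
    have hneg : W ◁ (-((λ_ E).hom ≫ q)) = -(W ◁ ((λ_ E).hom ≫ q)) := (tensorLeft W).map_neg
    simp only [transposeAlong, hneg, Preadditive.neg_comp, Preadditive.comp_neg]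
    rw [whiskerLeft_comp, Category.assoc, triangle_assoc, ← comp_whiskerRight_assoc,
      ← whisker_exchange_assoc]
    simp
  have hsub {T' W : A} (x y : T' ⟶ W ⊗ V) :
      transposeAlong δ (x - y) = transposeAlong δ x - transposeAlong δ y := by
    have hs : (x - y) ▷ E = x ▷ E - y ▷ E := (tensorRight E).map_sub
    simp only [transposeAlong, hs, Preadditive.sub_comp]
  have hpT {T' W : A} (x : T' ⟶ W ⊗ V) :
      T' ◁ f ≫ transposeAlong δ x = transposeAlong (ε_ E₁ T) (x ≫ W ◁ p) := by
    rw [whiskerLeft_transposeAlong, hδf, transposeAlong_comp_whiskerLeft]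
  have hex (W : A) := exact_whiskerLeft hVex W
  have hperf := isPerfectPairing_evaluation E₁ T
  -- Perfection for `E₁` shows that `x` comes locally from `W ⊗ 𝟙_ A`, where transposing is, up to
  -- sign, precomposition with an epimorphism.
  have inj {T' W : A} (x : T' ⟶ W ⊗ V) (hx : transposeAlong δ x = 0) : x = 0 := by
    have h0 : x ≫ W ◁ p = 0 := (hperf _ _).1 <| by
      rw [← hpT, hx, comp_zero]
      simp [transposeAlong]
    obtain ⟨T'', π, _, (y : T'' ⟶ W ⊗ 𝟙_ A), hy⟩ := (hex W).exact_up_to_refinements x h0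
    replace hy : π ≫ x = y ≫ W ◁ inr := hy
    have h1 := transposeAlong_comp δ π x
    rw [hx, comp_zero, hy, htr, neg_eq_zero, ← comp_zero (f := T'' ◁ q), cancel_epi,
      ← comp_zero (f := (ρ_ T'').hom), cancel_epi, ← zero_comp (f := (ρ_ W).hom), cancel_mono] at h1
    rw [← cancel_epi π, hy, h1, zero_comp, comp_zero]
  refine IsPerfectPairing.isDualizableObj (δ := δ) fun T' W => ⟨fun x y hxy => ?_, fun g => ?_⟩
  · rw [← sub_eq_zero]
    exact inj _ (by rw [hsub, hxy, sub_self])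
  -- The restriction of `g` to `E₁` is realized by `z`, which lifts to `W ⊗ V` after a cover `π`.
  -- The error factors through `q` and is corrected inside `W ⊗ 𝟙_ A`; injectivity descends the
  -- result along `π`.
  · obtain ⟨z, hz⟩ := (hperf _ _).2 (T' ◁ f ≫ g)
    obtain ⟨T'', π, _, x, hx⟩ := surjective_up_to_refinements_of_epi (W ◁ p) z
    obtain ⟨l, hl⟩ := exists_whiskerLeft_comp_eq hS T'' (π ▷ E ≫ g - transposeAlong δ x) (by
      change T'' ◁ f ≫ _ = 0
      rw [Preadditive.comp_sub, hpT, ← hx, transposeAlong_comp, hz, whisker_exchange_assoc,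
        sub_self])
    let x' : T'' ⟶ W ⊗ V := x - ((ρ_ T'').inv ≫ l ≫ (ρ_ W).inv) ≫ W ◁ inr
    have hx' : transposeAlong δ x' = π ▷ E ≫ g := by
      replace hl : T'' ◁ q ≫ l = π ▷ E ≫ g - transposeAlong δ x := hl
      rw [hsub, htr, sub_neg_eq_add]
      simp [hl]
    have hk : kernel.ι π ≫ x' = 0 := inj _ (by
      rw [transposeAlong_comp, hx', ← comp_whiskerRight_assoc, kernel.condition]
      simp)
    refine ⟨(shortExact_kernel π).exact.desc x' hk, ?_⟩
    have e : π ≫ (shortExact_kernel π).exact.desc x' hk = x' := (shortExact_kernel π).exact.g_desc _ _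
    rw [← cancel_epi (π ▷ E), ← transposeAlong_comp, e, hx']

/-- Tensoring with the inverse of `S.X₃` reduces to a unit quotient; tensoring with `S.X₃` goes
back. -/
lemma isDualizableObj_of_shortExact {S : ShortComplex A} (hS : S.ShortExact)
    (h₁ : IsDualizableObj S.X₁) (h₃ : IsInvertibleObj S.X₃) : IsDualizableObj S.X₂ := by
  obtain ⟨M, ⟨e⟩⟩ := h₃
  have hM : IsInvertibleObj M := ⟨S.X₃, ⟨β_ _ _ ≪≫ e⟩⟩
  have := hM.isEquivalence_tensorRight
  have := hS.mono_f
  have := hS.epi_g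
  have h := hS.map (tensorRight M)
  have h' : IsDualizableObj (S.X₂ ⊗ M) := isDualizableObj_of_shortExact_unit (S.f ▷ M)
    (S.g ▷ M ≫ e.hom) (by rw [← comp_whiskerRight_assoc, S.zero, zero_whiskerRight', zero_comp])
    (ShortComplex.shortExact_of_iso (S₁ := S.map (tensorRight M)) (ShortComplex.isoMk (Iso.refl _) (Iso.refl _) e
      ((Category.id_comp _).trans (Category.comp_id _).symm) (Category.id_comp _)) h) (h₁.tensor hM.isDualizableObj)
  refine (h'.tensor (IsInvertibleObj.isDualizableObj ⟨M, ⟨e⟩⟩)).of_iso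
    (α_ _ _ _ ≪≫ whiskerLeftIso _ (β_ _ _ ≪≫ e) ≪≫ ρ_ _)

lemma isDualizableObj_of_filtered {P : ObjectProperty A} (hP : P ≤ IsInvertibleObj) {X : A}
    (hX : Filtered P X) : IsDualizableObj X := by
  induction hX with
  | zero X hX =>
    refine IsPerfectPairing.isDualizableObj (V := X) (δ := 0) fun T W =>
      ⟨fun x y _ => ((tensorLeft W).map_isZero hX).eq_of_tgt _ _, fun g => ⟨0, ?_⟩⟩
    exact ((tensorLeft T).map_isZero hX).eq_of_src _ _
  | step S hS h₁ h₃ ih => exact isDualizableObj_of_shortExact hS ih (hP _ h₃)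

end Extensions

/-! ### Picard group actions and tensor ideals. -/

section Picard

variable {A : Type u} [Category.{v} A] [MonoidalCategory A]

lemma Pic.nonempty_iso_rep {L : Pic A} {M : A} (h : toSkeleton M = (L : Skeleton A)) :
    Nonempty (M ≅ L.rep) :=
  Quotient.exact (h.trans L.toSkeleton_rep.symm)

lemma Pic.isInvertibleObj_rep (L : Pic A) : IsInvertibleObj L.rep := by
  refine ⟨(L⁻¹).rep, ?_⟩
  obtain ⟨e⟩ := Pic.nonempty_rep_mul L L⁻¹
  obtain ⟨f⟩ := Pic.nonempty_rep_one (A := A)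
  rw [mul_inv_cancel] at e
  exact ⟨e.symm ≪≫ f⟩

lemma IsInvertibleObj.of_iso {L L' : A} (e : L ≅ L') (h : IsInvertibleObj L) :
    IsInvertibleObj L' := by
  obtain ⟨M, ⟨f⟩⟩ := h
  exact ⟨M, ⟨whiskerRightIso e.symm M ≪≫ f⟩⟩

lemma tensorPowers_le_isInvertibleObj (𝓛 : Set (Pic A)) : tensorPowers 𝓛 ≤ IsInvertibleObj := by
  rintro M ⟨L, -, n, h⟩
  exact (Pic.isInvertibleObj_rep (L ^ n)).of_iso (Pic.nonempty_iso_rep h).some.symm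

lemma isInvertibleObj_le_tensorPowers_univ [SymmetricCategory A] :
    (IsInvertibleObj : ObjectProperty A) ≤ tensorPowers Set.univ := by
  rintro L ⟨M, ⟨e⟩⟩
  have h₁ : toSkeleton L * toSkeleton M = 1 := by
    rw [← Skeleton.toSkeleton_tensorObj]
    exact Quotient.sound ⟨e⟩
  have h₂ : toSkeleton M * toSkeleton L = 1 := by
    rw [← Skeleton.toSkeleton_tensorObj]
    exact Quotient.sound ⟨β_ _ _ ≪≫ e⟩
  exact ⟨⟨toSkeleton L, toSkeleton M, h₁, h₂⟩, trivial, 1, by rw [zpow_one]⟩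

variable [SymmetricCategory A] {𝓛 : Set (Pic A)} {P : ObjectProperty A}

lemma IsLClosed.isClosed_picAction (hP : IsLClosed P)
    (H : Subgroup (Pic A)) : ((picAction A).restrict H).IsClosed P :=
  fun g X hX => hP X _ hX (Pic.isInvertibleObj_rep g.1)

lemma prop_tensor_of_mem_tensorPowers [P.IsClosedUnderIsomorphisms]
    (hP : ((picAction A).restrict (Subgroup.closure 𝓛)).IsClosed P) {X M : A} (hX : P X)
    (hM : tensorPowers 𝓛 M) : P (X ⊗ M) := by
  obtain ⟨L, hL, n, h⟩ := hM
  exact P.prop_of_iso (whiskerLeftIso X (Pic.nonempty_iso_rep h).some.symm)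
    (hP ⟨L ^ n, Subgroup.zpow_mem _ (Subgroup.subset_closure hL) n⟩ X hX)

variable [Abelian A] [MonoidalClosed A]

/-- The `M` with `X ⊗ M` in `P` form a torsion class containing the tensor powers. -/
lemma IsTorsionClass.prop_tensor_of_filtered (hPt : IsTorsionClass P)
    (hP : ((picAction A).restrict (Subgroup.closure 𝓛)).IsClosed P) {X M : A} (hX : P X)
    (hM : Filtered (tensorPowers 𝓛) M) : P (X ⊗ M) := by
  have := hPt.quotients
  have h := hPt.inverseImage (tensorLeft X)
  have := h.containsZero
  have := h.quotients
  have := h.extensions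
  exact Filtered.le_of_le (Q := P.inverseImage (tensorLeft X))
    (fun M hM => prop_tensor_of_mem_tensorPowers hP hX hM) M hM

lemma condC2_of_generatedBySmallSetOf (h : GeneratedBySmallSetOf (Filtered (tensorPowers 𝓛))) :
    CondC2 A := by
  obtain ⟨ι, E, hE, hsep⟩ := h
  exact ⟨ι, E, fun i => isDualizableObj_of_filtered (tensorPowers_le_isInvertibleObj 𝓛) (hE i),
    hsep⟩

variable [IsGrothendieckAbelian.{v} A]

lemma IsLocalizingSubcat.isTensorIdeal (h : GeneratedBySmallSetOf (Filtered (tensorPowers 𝓛)))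
    (hPl : IsLocalizingSubcat P)
    (hP : ((picAction A).restrict (Subgroup.closure 𝓛)).IsClosed P) : IsTensorIdeal P := by
  intro X M hX
  have := hPl.serre
  obtain ⟨ι, E, hE, hsep⟩ := h
  -- `M` is a quotient of a coproduct of generators, and `X ⊗ -` preserves both.
  let π : (∐ fun k : Σ i, (E i ⟶ M) => E k.1) ⟶ M := Sigma.desc fun k => k.2
  have : Epi π := by
    refine Preadditive.epi_of_cokernel_zero (hsep _ _ ?_)
    rintro _ ⟨i⟩ f
    have : f = Sigma.ι (fun k : Σ i, (E i ⟶ M) => E k.1) ⟨i, f⟩ ≫ π := by simp [π]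
    rw [this, Category.assoc, cokernel.condition, comp_zero, comp_zero]
  have h : P (∐ fun k : Σ i, (E i ⟶ M) => X ⊗ E k.1) := hPl.coproducts _ _ fun k =>
    IsTorsionClass.prop_tensor_of_filtered ⟨inferInstance, inferInstance, inferInstance⟩ hP hX
      (hE k.1)
  exact P.prop_of_epi (X ◁ π) (P.prop_of_iso (PreservesCoproduct.iso (tensorLeft X) _).symm h)

lemma tensorLoc_eq (h : GeneratedBySmallSetOf (Filtered (tensorPowers 𝓛))) :
    tensorLoc A = ((picAction A).restrict (Subgroup.closure 𝓛)).loc := by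
  ext P
  exact ⟨fun ⟨hl, hP⟩ => ⟨hl, IsLClosed.isClosed_picAction (fun X L hX _ => hP X L hX) _⟩,
    fun ⟨hl, hP⟩ => ⟨hl, hl.isTensorIdeal h hP⟩⟩

lemma tensorTorsNoeth_eq (hA : IsLocallyNoetherianCat A) (hC1 : CondC1 A)
    (h : GeneratedBySmallSetOf (Filtered (tensorPowers 𝓛))) :
    tensorTorsNoeth A = ((picAction A).restrict (Subgroup.closure 𝓛)).torsNoeth := by
  ext P
  refine ⟨fun ⟨hn, ht, hP⟩ => ⟨hn, ht, IsLClosed.isClosed_picAction (fun X L hX hL =>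
    hP X L hX (hL.isDualizableObj.isNoetherian hA hC1)) _⟩, fun ⟨hn, ht, hP⟩ => ⟨hn, ht, ?_⟩⟩
  intro X M hX hM
  obtain ⟨ι, E, hE, hsep⟩ := h
  refine (ht.inverseImage (tensorLeft X)).prop_of_isSeparating hsep ?_ hM
  rintro _ ⟨i⟩
  exact ht.prop_tensor_of_filtered hP hX (hE i)

end Picard

theorem mainTheorem1 {A : Type u} [Category.{v} A] [Abelian A] [IsGrothendieckAbelian.{v} A]
    [MonoidalCategory A] [SymmetricCategory A] [MonoidalClosed A]
    (hA : IsLocallyNoetherianCat A) (hC1 : CondC1 A) :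
    -- the equivalences, for an arbitrary group action
    (∀ {G : Type w} [Group G] (ρ : WeakAction G A),
      CondC2 A → tensorLoc A = ρ.loc → tensorTorsNoeth A = ρ.torsNoeth →
      ∀ X : ObjectProperty A, X.IsClosedUnderIsomorphisms → X ≤ isNoetherianObject →
        ρ.IsClosed X →
        [X.IsSerreClass, IsTorsionClass X, IsWide X, IsICEClosed X, IsCEClosed X].TFAE ∧
        [IsTorsionFreeClass X, IsIKEClosed X, IsIEClosed X].TFAE) ∧
    -- the hypotheses hold when `A` is generated by filtered objects, for the action of the
    -- subgroup of the Picard group generated by `𝓛`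
    (∀ 𝓛 : Set (Pic A), GeneratedBySmallSetOf (Filtered (tensorPowers 𝓛)) →
      CondC2 A ∧
      tensorLoc A = ((picAction A).restrict (Subgroup.closure 𝓛)).loc ∧
      tensorTorsNoeth A = ((picAction A).restrict (Subgroup.closure 𝓛)).torsNoeth) ∧
    -- the equivalences for L-closed subcategories when `A` is generated by invertible-filtered
    -- objects
    (GeneratedBySmallSetOf (Filtered (IsInvertibleObj : ObjectProperty A)) →
      ∀ X : ObjectProperty A, X.IsClosedUnderIsomorphisms → X ≤ isNoetherianObject →
        IsLClosed X →
        [X.IsSerreClass, IsTorsionClass X, IsWide X, IsICEClosed X, IsCEClosed X].TFAE ∧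
        [IsTorsionFreeClass X, IsIKEClosed X, IsIEClosed X].TFAE) := by
  have hII (𝓛 : Set (Pic A)) (h : GeneratedBySmallSetOf (Filtered (tensorPowers 𝓛))) :
      CondC2 A ∧
      tensorLoc A = ((picAction A).restrict (Subgroup.closure 𝓛)).loc ∧
      tensorTorsNoeth A = ((picAction A).restrict (Subgroup.closure 𝓛)).torsNoeth :=
    ⟨condC2_of_generatedBySmallSetOf h, tensorLoc_eq h, tensorTorsNoeth_eq hA hC1 h⟩
  refine ⟨fun ρ hC2 _ ht X _ hX hXG => tfae_of_tensorTorsNoeth_eq hA hC1 hC2 ht hX hXG, hII, ?_⟩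
  rintro ⟨ι, E, hE, hsep⟩ X _ hX hXL
  -- Every invertible object is the first power of its own class.
  obtain ⟨hC2, -, ht⟩ := hII Set.univ ⟨ι, E, fun i => Filtered.le_of_le
    (fun L hL => .of_prop (isInvertibleObj_le_tensorPowers_univ L hL)) _ (hE i), hsep⟩
  exact tfae_of_tensorTorsNoeth_eq hA hC1 hC2 ht hX (IsLClosed.isClosed_picAction hXL _)
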